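/- A deflation-exact structure on an additive category $\mathcal C$ is a class of kernel-cokernel pairs $X\to Y\to Z$, called conflations, closed under isomorphisms; the second map of a conflation is called a deflation, and it is required that every morphism to a zero object is a deflation, that compositions of deflations are deflations, and that pullbacks of deflations along arbitrary morphisms exist and are deflations. A cochain complex $X^\bullet$ in $\mathcal C$ is acyclic if there are conflations $Z^i\to X^i\to Z^{i+1}$ ($i\in\mathbb Z$) such that each differential $X^i\to X^{i+1}$ is the composite $X^i\to Z^{i+1}\to X^{i+1}$. For $*\in\{-,b\}$, let $\mathbf K^{*}(\mathcal C)$ be the homotopy category of right bounded, respectively bounded, cochain complexes, and let $\mathbf D^{*}(\mathcal C)$ be the Verdier quotient of $\mathbf K^{*}(\mathcal C)$ by the thick closure of the acyclic complexes in it. Let $\mathcal E$ be a deflation-exact category (an additive category with a deflation-exact structure) and let $\mathcal A\subseteq\mathcal E$ be a full additive subcategory. A conflation $A\to B\xrightarrow{g} C$ of $\mathcal E$ with $A,B,C\in\mathcal A$ is called an $\mathcal A$-conflation if for every morphism $h\colon D\to C$ with $D\in\mathcal A$ the pullback of $g$ along $h$ in $\mathcal E$ belongs to $\mathcal A$. Assume: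 * (C1) for every $E\in\mathcal E$ there is a deflation $A\to E$ with $A\in\mathcal A$; * (C2') for every conflation $X\to Y\to C$ of $\mathcal E$ with $C\in\mathcal A$ there are an $\mathcal A$-conflation $A\to B\to C$ and morphisms $A\to X$, $B\to Y$ which, together with $1_C$, form a morphism from $A\to B\to C$ to $X\to Y\to C$. Then: 1. The $\mathcal A$-conflations form a deflation-exact structure on $\mathcal A$, and it is the largest deflation-exact structure on $\mathcal A$ whose conflations are conflations of $\mathcal E$. Endow $\mathcal A$ with it. 2. The functor $\mathbf D^{-}(\mathcal A)\to\mathbf D^{-}(\mathcal E)$ induced by the inclusion is a triangle equivalence. 3. Suppose that every $E\in\mathcal E$ has finite resolution dimension, i.e. for every $E$ there are an $n\ge 0$ and an exact sequence (acyclic complex) $0\to A^{-n}\to\cdots\to A^{0}\to E\to 0$ in $\mathcal E$ with all $A^{i}\in\mathcal A$. Then the functor $\mathbf D^{b}(\mathcal A)\to\mathbf D^{b}(\mathcal E)$ induced by the inclusion is a triangle equivalence; in particular it is essentially surjective. -/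

import Mathlib

open CategoryTheory Limits Pretriangulated ZeroObject

universe v u v' u'

noncomputable section

namespace OneSidedExact

section Conflations

variable {C : Type u} [Category.{v} C] [Preadditive C]

/-- A short complex `X ⟶ Y ⟶ Z` is a kernel-cokernel pair if the first map is a kernel of the
second and the second map is a cokernel of the first. -/
def IsKernelCokernelPair (S : ShortComplex C) : Prop :=
  Nonempty (IsLimit (KernelFork.ofι S.f S.zero)) ∧
    Nonempty (IsColimit (CokernelCofork.ofπ S.g S.zero))

/-- A morphism is a deflation for a class `conf` of short complexes if it is the cokernel part
of a member of `conf`. -/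
def IsDeflation (conf : ObjectProperty (ShortComplex C)) {Y Z : C} (p : Y ⟶ Z) : Prop :=
  ∃ (X : C) (i : X ⟶ Y) (w : i ≫ p = 0), conf (ShortComplex.mk i p w)

/-- The class `conf` is a deflation-exact structure on the additive category `C`: a class of
kernel-cokernel pairs (the conflations), closed under isomorphisms, which satisfies the axioms
`R0`, `R1` and `R2`. -/
structure IsDeflationExact (conf : ObjectProperty (ShortComplex C)) : Prop where
  kernelCokernelPair : ∀ S : ShortComplex C, conf S → IsKernelCokernelPair S
  closedUnderIso : ∀ S T : ShortComplex C, Nonempty (S ≅ T) → conf S → conf T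
  /-- `R0`: every morphism to a zero object is a deflation. -/
  r0 : ∀ {X Z : C} (f : X ⟶ Z), IsZero Z → IsDeflation conf f
  /-- `R1`: deflations are closed under composition. -/
  r1 : ∀ {X Y Z : C} (p : X ⟶ Y) (q : Y ⟶ Z), IsDeflation conf p → IsDeflation conf q →
    IsDeflation conf (p ≫ q)
  /-- `R2`, existence: the pullback of a deflation along any morphism exists. -/
  r2_exists : ∀ {Y Z W : C} (p : Y ⟶ Z) (h : W ⟶ Z), IsDeflation conf p →
    ∃ (Q : C) (a : Q ⟶ Y) (b : Q ⟶ W), IsPullback a b p h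
  /-- `R2`, stability: a pullback of a deflation is a deflation. -/
  r2_stable : ∀ {Q Y Z W : C} (a : Q ⟶ Y) (b : Q ⟶ W) (p : Y ⟶ Z) (h : W ⟶ Z),
    IsPullback a b p h → IsDeflation conf p → IsDeflation conf b

/-- A cochain complex is acyclic if there are conflations
`Z i ⟶ X i ⟶ Z (i + 1)` such that each differential `X i ⟶ X (i + 1)` is the composition of the
deflation `X i ⟶ Z (i + 1)` and the inflation `Z (i + 1) ⟶ X (i + 1)`. (In other words, the
differentials are admissible and the kernel of each is the image of the preceding one.) -/
def IsAcyclic (conf : ObjectProperty (ShortComplex C)) (X : CochainComplex C ℤ) : Prop :=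
  ∃ (Z : ℤ → C) (j : ∀ i, Z i ⟶ X.X i) (p : ∀ i, X.X i ⟶ Z (i + 1)),
    (∀ i, ∃ w : j i ≫ p i = 0, conf (ShortComplex.mk (j i) (p i) w)) ∧
      ∀ i, p i ≫ j (i + 1) = X.d i (i + 1)

end Conflations

section Subcategories

variable {E : Type u} [Category.{v} E] [Preadditive E]
  (conf : ObjectProperty (ShortComplex E)) (A : ObjectProperty E)

/-- The `A`-conflations, for a full subcategory `A` of `E`: those conflations `X ⟶ Y ⟶ Z` of `E`
with terms in `A` such that, for every morphism `D ⟶ Z` in `A`, the pullback in `E` of `Y ⟶ Z`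
along `D ⟶ Z` belongs to `A`. -/
def subConflation : ObjectProperty (ShortComplex A.FullSubcategory) := fun S =>
  conf (S.map A.ι) ∧
    ∀ (D : A.FullSubcategory) (h : D ⟶ S.X₃),
      ∃ (Q : A.FullSubcategory) (a : Q ⟶ S.X₂) (b : Q ⟶ D),
        IsPullback (A.ι.map a) (A.ι.map b) (A.ι.map S.g) (A.ι.map h)

/-- Axiom `C1`: every object of `E` admits a deflation from an object of `A`. -/
def AxiomC1 : Prop :=
  ∀ X : E, ∃ (Y : E) (p : Y ⟶ X), A Y ∧ IsDeflation conf p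

/-- Axiom `C2'`: every conflation `X ⟶ Y ⟶ Z` of `E` with `Z` in `A` receives a morphism, which
is the identity on `Z`, from an `A`-conflation `K ⟶ B ⟶ Z`. -/
def AxiomC2' : Prop :=
  ∀ (X Y : E) (Z : A.FullSubcategory) (i : X ⟶ Y) (p : Y ⟶ Z.obj) (w : i ≫ p = 0),
    conf (ShortComplex.mk i p w) →
      ∃ (K B : A.FullSubcategory) (i' : K ⟶ B) (p' : B ⟶ Z) (w' : i' ≫ p' = 0)
        (f : K.obj ⟶ X) (g : B.obj ⟶ Y),
        subConflation conf A (ShortComplex.mk i' p' w') ∧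
          A.ι.map i' ≫ g = f ≫ i ∧ g ≫ p = A.ι.map p'

/-- There is an exact sequence `0 ⟶ Aⁿ ⟶ ⋯ ⟶ A⁰ ⟶ X ⟶ 0` in `E` with `n + 1` terms in `A`:
it is encoded as an acyclic cochain complex with `X` in degree `1`, objects of `A` in the degrees
`-n, …, 0`, and zero objects in all other degrees. -/
def HasResolutionOfLength (X : E) (n : ℕ) : Prop :=
  ∃ R : CochainComplex E ℤ, IsAcyclic conf R ∧ Nonempty (R.X 1 ≅ X) ∧
    (∀ i : ℤ, -(n : ℤ) ≤ i → i ≤ 0 → A (R.X i)) ∧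
    (∀ i : ℤ, (i < -(n : ℤ) ∨ 1 < i) → IsZero (R.X i))

/-- The resolution dimension of `X` with respect to `A`: the smallest length of a finite
resolution of `X` by objects of `A`, and `⊤` if there is none. -/
def resolutionDimension (X : E) : ℕ∞ :=
  ⨅ (n : ℕ) (_ : HasResolutionOfLength conf A X n), (n : ℕ∞)

end Subcategories

section Verdier

variable {T : Type u} [Category.{v} T] [HasZeroObject T] [HasShift T ℤ] [Preadditive T]
  [∀ n : ℤ, (shiftFunctor T n).Additive] [Pretriangulated T]

/-- The thick closure of a class of objects: the smallest triangulated subcategory that is closed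
under direct summands and contains the class. -/
def thickClosure (N : ObjectProperty T) : ObjectProperty T := fun X =>
  ∀ Q : ObjectProperty T, Q.IsTriangulated → Q.IsStableUnderRetracts → N ≤ Q → Q X

lemma le_thickClosure (N : ObjectProperty T) : N ≤ thickClosure N :=
  fun X hX _ _ _ h => h X hX

instance (N : ObjectProperty T) : (thickClosure N).IsStableUnderRetracts where
  of_retract r hY Q h₁ h₂ h := ObjectProperty.prop_of_retract Q r (hY Q h₁ h₂ h)

instance (N : ObjectProperty T) : (thickClosure N).IsTriangulated where
  exists_zero := ⟨0, isZero_zero T, fun Q _ _ _ => Q.prop_zero⟩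
  isStableUnderShiftBy n := ⟨fun X hX Q h₁ h₂ h => Q.le_shift n X (hX Q h₁ h₂ h)⟩
  toIsTriangulatedClosed₂ := .mk' (fun D hD h₁ h₃ Q hQ₁ hQ₂ h =>
    Q.ext_of_isTriangulatedClosed₂ D hD (h₁ Q hQ₁ hQ₂ h) (h₃ Q hQ₁ hQ₂ h))

/-- The Verdier quotient of `T` by the thick closure of `N`. -/
abbrev VerdierQuotient (N : ObjectProperty T) : Type _ :=
  (thickClosure N).trW.Localization

variable {T' : Type u'} [Category.{v'} T'] [HasZeroObject T'] [HasShift T' ℤ] [Preadditive T']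
  [∀ n : ℤ, (shiftFunctor T' n).Additive] [Pretriangulated T']

variable {N : ObjectProperty T} {N' : ObjectProperty T'} (G : T ⥤ T') [G.CommShift ℤ]
  [G.IsTriangulated]

instance (Q : ObjectProperty T') [Q.IsStableUnderRetracts] :
    (Q.inverseImage G).IsStableUnderRetracts where
  of_retract r h := ObjectProperty.prop_of_retract Q (r.map G) h

lemma thickClosure_le_inverseImage (hG : N ≤ N'.inverseImage G) :
    thickClosure N ≤ (thickClosure N').inverseImage G := fun _ hX =>
  hX ((thickClosure N').inverseImage G) inferInstance inferInstance
    (fun _ hY => le_thickClosure N' _ (hG _ hY))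

lemma inverts_of_le (hG : N ≤ N'.inverseImage G) :
    (thickClosure N).trW.IsInvertedBy (G ⋙ (thickClosure N').trW.Q) := by
  rintro X Y f ⟨Z, g, h, hT, hZ⟩
  exact Localization.inverts (thickClosure N').trW.Q (thickClosure N').trW _
    (ObjectProperty.trW.mk _ (G.map_distinguished _ hT)
      (thickClosure_le_inverseImage G hG _ hZ))

/-- The functor between Verdier quotients induced by a triangulated functor `G` which maps the
objects of `N` to objects of `N'`. -/
def verdierFunctor (hG : N ≤ N'.inverseImage G) : VerdierQuotient N ⥤ VerdierQuotient N' :=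
  Localization.lift (G ⋙ (thickClosure N').trW.Q) (inverts_of_le G hG) (thickClosure N).trW.Q

instance (hG : N ≤ N'.inverseImage G) :
    Localization.Lifting (thickClosure N).trW.Q (thickClosure N).trW
      (G ⋙ (thickClosure N').trW.Q) (verdierFunctor G hG) :=
  inferInstanceAs (Localization.Lifting (thickClosure N).trW.Q (thickClosure N).trW
    (G ⋙ (thickClosure N').trW.Q) (Localization.lift _ (inverts_of_le G hG) _))

/-- The compatibility of the induced functor with the shifts comes from that of `G`. -/
instance [IsTriangulated T] [IsTriangulated T'] (hG : N ≤ N'.inverseImage G) :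
    (verdierFunctor G hG).CommShift ℤ :=
  Functor.commShiftOfLocalization (thickClosure N).trW.Q (thickClosure N).trW ℤ
    (G ⋙ (thickClosure N').trW.Q) (verdierFunctor G hG)

end Verdier

section HomotopyCategories

variable (C : Type u) [Category.{v} C] [Preadditive C]

/-- The complexes in the homotopy category which are bounded above (right bounded). -/
def minus : ObjectProperty (HomotopyCategory C (.up ℤ)) := fun K =>
  ∃ n : ℤ, CochainComplex.IsStrictlyLE (C := C) K.as n

/-- The bounded complexes in the homotopy category. -/
def bounded : ObjectProperty (HomotopyCategory C (.up ℤ)) := fun K =>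
  ∃ m n : ℤ, CochainComplex.IsStrictlyGE (C := C) K.as m ∧
    CochainComplex.IsStrictlyLE (C := C) K.as n

variable {C} in
lemma minus_quotient_obj_iff (K : CochainComplex C ℤ) :
    minus C ((HomotopyCategory.quotient _ _).obj K) ↔ ∃ n : ℤ, K.IsStrictlyLE n := Iff.rfl

variable {C} in
lemma bounded_quotient_obj_iff (K : CochainComplex C ℤ) :
    bounded C ((HomotopyCategory.quotient _ _).obj K) ↔
      ∃ m n : ℤ, K.IsStrictlyGE m ∧ K.IsStrictlyLE n := Iff.rfl

variable {C} in
lemma isStrictlyLE_mappingCone {K L : CochainComplex C ℤ} [HasBinaryBiproducts C] (f : K ⟶ L)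
    (a b : ℤ) [K.IsStrictlyLE a] [L.IsStrictlyLE b] :
    (CochainComplex.mappingCone f).IsStrictlyLE (max a b) := by
  rw [CochainComplex.isStrictlyLE_iff]
  intro i hi
  simp only [CochainComplex.mappingCone.isZero_X_iff]
  have := le_max_left a b
  have := le_max_right a b
  exact ⟨K.isZero_of_isStrictlyLE a _, L.isZero_of_isStrictlyLE b _⟩

instance : (minus C).IsStableUnderShift ℤ where
  isStableUnderShiftBy n := ⟨by
    intro K hK
    obtain ⟨K : CochainComplex _ _, rfl⟩ := K.quotient_obj_surjective
    rw [minus_quotient_obj_iff] at hK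
    obtain ⟨q, hq⟩ := hK
    rw [ObjectProperty.prop_shift_iff, HomotopyCategory.shift_quotient_obj,
      minus_quotient_obj_iff]
    exact ⟨q - n, K.isStrictlyLE_shift q n (q - n) (by lia)⟩⟩

instance : (bounded C).IsStableUnderShift ℤ where
  isStableUnderShiftBy n := ⟨by
    intro K hK
    obtain ⟨K : CochainComplex _ _, rfl⟩ := K.quotient_obj_surjective
    rw [bounded_quotient_obj_iff] at hK
    obtain ⟨p, q, hp, hq⟩ := hK
    rw [ObjectProperty.prop_shift_iff, HomotopyCategory.shift_quotient_obj,
      bounded_quotient_obj_iff]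
    exact ⟨p - n, q - n, K.isStrictlyGE_shift p n (p - n) (by lia),
      K.isStrictlyLE_shift q n (q - n) (by lia)⟩⟩

variable [HasZeroObject C] [HasBinaryBiproducts C]

instance : (minus C).IsTriangulatedClosed₃ where
  ext₃' T hT h₁ h₂ := by
    obtain ⟨n₁, h₁⟩ := h₁
    obtain ⟨n₂, h₂⟩ := h₂
    obtain ⟨f : T.obj₁.as ⟶ T.obj₂.as, hf⟩ :=
      (HomotopyCategory.quotient _ _).map_surjective T.mor₁
    exact ⟨_, ⟨_, isStrictlyLE_mappingCone f n₁ n₂⟩,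
      ⟨Triangle.π₃.mapIso (isoTriangleOfIso₁₂ T _ hT
        (HomotopyCategory.mappingCone_triangleh_distinguished f)
        (Iso.refl _) (Iso.refl _)
        ((Category.comp_id _).trans (hf.symm.trans (Category.id_comp _).symm)))⟩⟩

instance : (minus C).IsTriangulated where
  exists_zero := ⟨(HomotopyCategory.quotient _ _).obj 0, Functor.map_isZero _ (isZero_zero _),
    ⟨0, inferInstanceAs (CochainComplex.IsStrictlyLE (0 : CochainComplex C ℤ) 0)⟩⟩
  toIsTriangulatedClosed₂ := .of_isTriangulatedClosed₃

instance : (bounded C).IsTriangulatedClosed₃ where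
  ext₃' T hT h₁ h₂ := by
    obtain ⟨m₁, n₁, g₁, h₁⟩ := h₁
    obtain ⟨m₂, n₂, g₂, h₂⟩ := h₂
    obtain ⟨f : T.obj₁.as ⟶ T.obj₂.as, hf⟩ :=
      (HomotopyCategory.quotient _ _).map_surjective T.mor₁
    exact ⟨_, ⟨min (m₁ - 1) m₂, _,
        CochainComplex.isStrictlyGE_mappingCone f m₁ m₂ _ (by simp) (by simp),
        isStrictlyLE_mappingCone f n₁ n₂⟩,
      ⟨Triangle.π₃.mapIso (isoTriangleOfIso₁₂ T _ hT
        (HomotopyCategory.mappingCone_triangleh_distinguished f)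
        (Iso.refl _) (Iso.refl _)
        ((Category.comp_id _).trans (hf.symm.trans (Category.id_comp _).symm)))⟩⟩

instance : (bounded C).IsTriangulated where
  exists_zero := ⟨(HomotopyCategory.quotient _ _).obj 0, Functor.map_isZero _ (isZero_zero _),
    ⟨0, 0, inferInstanceAs (CochainComplex.IsStrictlyGE (0 : CochainComplex C ℤ) 0),
      inferInstanceAs (CochainComplex.IsStrictlyLE (0 : CochainComplex C ℤ) 0)⟩⟩
  toIsTriangulatedClosed₂ := .of_isTriangulatedClosed₃

end HomotopyCategories

section DerivedCategories

variable {C : Type u} [Category.{v} C] [Preadditive C]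

/-- The acyclic complexes, as a class of objects of the full subcategory of the homotopy category
that is defined by a boundedness condition `B`. -/
def acyclicIn (B : ObjectProperty (HomotopyCategory C (.up ℤ)))
    (conf : ObjectProperty (ShortComplex C)) : ObjectProperty B.FullSubcategory := fun K =>
  IsAcyclic conf K.obj.as

variable [HasZeroObject C] [HasBinaryBiproducts C]

/-- The right bounded derived category: the Verdier quotient of the right bounded homotopy
category by the thick closure of the right bounded acyclic complexes. -/
abbrev DMinus (conf : ObjectProperty (ShortComplex C)) : Type _ :=
  VerdierQuotient (acyclicIn (minus C) conf)

/-- The bounded derived category: the Verdier quotient of the bounded homotopy category by the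
thick closure of the bounded acyclic complexes. -/
abbrev DBounded (conf : ObjectProperty (ShortComplex C)) : Type _ :=
  VerdierQuotient (acyclicIn (bounded C) conf)

end DerivedCategories

section DerivedFunctors

variable {C : Type u} [Category.{v} C] [Preadditive C]
  {D : Type u'} [Category.{v'} D] [Preadditive D] (F : C ⥤ D) [F.Additive]

/-- The functor between right bounded homotopy categories induced by an additive functor. -/
def mapKMinus : (minus C).FullSubcategory ⥤ (minus D).FullSubcategory :=
  (minus D).lift ((minus C).ι ⋙ F.mapHomotopyCategory (.up ℤ)) (by
    rintro ⟨X, hX⟩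
    obtain ⟨K : CochainComplex C ℤ, rfl⟩ := HomotopyCategory.quotient_obj_surjective X
    rw [minus_quotient_obj_iff] at hX
    obtain ⟨n, hn⟩ := hX
    exact ⟨n, inferInstanceAs (CochainComplex.IsStrictlyLE
      ((F.mapHomologicalComplex _).obj K) n)⟩)

/-- The functor between bounded homotopy categories induced by an additive functor. -/
def mapKBounded : (bounded C).FullSubcategory ⥤ (bounded D).FullSubcategory :=
  (bounded D).lift ((bounded C).ι ⋙ F.mapHomotopyCategory (.up ℤ)) (by
    rintro ⟨X, hX⟩
    obtain ⟨K : CochainComplex C ℤ, rfl⟩ := HomotopyCategory.quotient_obj_surjective X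
    rw [bounded_quotient_obj_iff] at hX
    obtain ⟨m, n, hm, hn⟩ := hX
    exact ⟨m, n, inferInstanceAs (CochainComplex.IsStrictlyGE
      ((F.mapHomologicalComplex _).obj K) m), inferInstanceAs (CochainComplex.IsStrictlyLE
      ((F.mapHomologicalComplex _).obj K) n)⟩)

instance : (mapKMinus F).CommShift ℤ :=
  inferInstanceAs (((minus D).lift ((minus C).ι ⋙ F.mapHomotopyCategory (.up ℤ)) _).CommShift ℤ)

instance : (mapKBounded F).CommShift ℤ :=
  inferInstanceAs
    (((bounded D).lift ((bounded C).ι ⋙ F.mapHomotopyCategory (.up ℤ)) _).CommShift ℤ)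

/-- An additive functor is conflation-exact if it maps conflations to conflations. -/
def IsConflationExact (confC : ObjectProperty (ShortComplex C))
    (confD : ObjectProperty (ShortComplex D)) : Prop :=
  ∀ S : ShortComplex C, confC S → confD (S.map F)

variable {F} {confC : ObjectProperty (ShortComplex C)} {confD : ObjectProperty (ShortComplex D)}

lemma IsConflationExact.isAcyclic (hF : IsConflationExact F confC confD)
    {X : CochainComplex C ℤ} (hX : IsAcyclic confC X) :
    IsAcyclic confD ((F.mapHomologicalComplex (.up ℤ)).obj X) := by
  obtain ⟨Z, j, p, h, hd⟩ := hX
  refine ⟨fun i => F.obj (Z i), fun i => F.map (j i), fun i => F.map (p i), fun i => ?_,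
    fun i => ?_⟩
  · obtain ⟨w, hw⟩ := h i
    exact ⟨(F.map_comp _ _).symm.trans ((congrArg F.map w).trans (F.map_zero _ _)), hF _ hw⟩
  · exact (F.map_comp _ _).symm.trans (congrArg F.map (hd i))

lemma IsConflationExact.acyclicIn_minus (hF : IsConflationExact F confC confD) :
    acyclicIn (minus C) confC ≤ (acyclicIn (minus D) confD).inverseImage (mapKMinus F) :=
  fun _ hK => hF.isAcyclic hK

lemma IsConflationExact.acyclicIn_bounded (hF : IsConflationExact F confC confD) :
    acyclicIn (bounded C) confC ≤ (acyclicIn (bounded D) confD).inverseImage (mapKBounded F) :=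
  fun _ hK => hF.isAcyclic hK

variable [HasZeroObject C] [HasBinaryBiproducts C] [HasZeroObject D] [HasBinaryBiproducts D]

instance : (mapKMinus F).IsTriangulated := by
  have : ((minus C).ι ⋙ F.mapHomotopyCategory (.up ℤ)).IsTriangulated := inferInstance
  exact ObjectProperty.isTriangulated_lift (minus D)
    ((minus C).ι ⋙ F.mapHomotopyCategory (.up ℤ)) _

instance : (mapKBounded F).IsTriangulated := by
  have : ((bounded C).ι ⋙ F.mapHomotopyCategory (.up ℤ)).IsTriangulated := inferInstance
  exact ObjectProperty.isTriangulated_lift (bounded D)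
    ((bounded C).ι ⋙ F.mapHomotopyCategory (.up ℤ)) _

/-- The functor between right bounded derived categories induced by a conflation-exact functor. -/
abbrev mapDMinus (hF : IsConflationExact F confC confD) : DMinus confC ⥤ DMinus confD :=
  verdierFunctor (mapKMinus F) hF.acyclicIn_minus

/-- The functor between bounded derived categories induced by a conflation-exact functor. -/
abbrev mapDBounded (hF : IsConflationExact F confC confD) : DBounded confC ⥤ DBounded confD :=
  verdierFunctor (mapKBounded F) hF.acyclicIn_bounded

end DerivedFunctors

/-- The inclusion of a full subcategory `A` of `E`, with its `A`-conflations, is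
conflation-exact. -/
lemma isConflationExact_ι {E : Type u} [Category.{v} E] [Preadditive E]
    (conf : ObjectProperty (ShortComplex E)) (A : ObjectProperty E) :
    IsConflationExact A.ι (subConflation conf A) conf :=
  fun _ h => h.1

end OneSidedExact

end

noncomputable section

namespace OneSidedExact

/-! ### Conflation calculus from the one-sided axioms -/

section Elementary

variable {C : Type u} [Category.{v} C] [Preadditive C]

/-! The first assertion is formal. Pasting of pullbacks gives the axioms for the `A`-conflations.
For maximality, let a deflation of some other structure on `A` be given. Its pullback in `A` and its
pullback in `E` sit in conflations of `E` with the same outer terms, so by the short five lemma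
(`isIso_of_conf`) they agree, and the pullback in `E` lies in `A`.

The derived statements rest on one construction, `exists_resolution`. Given a chain map `f : G X ⟶
N` with `X` right bounded, build `Y ⟶ X` by descending induction on the degree: pull the previous
deflation back along the map from `X` to get `P`, then cover `P` by a deflation `Y ⟶ P`. The cone of
`Y ⟶ X` is acyclic with cycle objects `P` (`isAcyclic_mappingCone`). If the coverings also lift the
induced maps from `P` to the cycles of `N`, these lifts form a null-homotopy of `G Y ⟶ G X ⟶ N`.

For `G` the inclusion of `A` and `N` acyclic in `E`, such coverings come from C2'. Hence every map
from a complex over `A` to an acyclic complex over `E` factors through an acyclic complex over `A`.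
This is Verdier's criterion (`FactorsThroughThickClosure`) for the induced functor of quotients to
be fully faithful. If `N` vanishes in low degrees, the coverings there can be identities, so bounded
complexes remain bounded.

In the right bounded case, essential surjectivity is the same construction with `N = 0` and
coverings from C1. In the bounded case the essential image of the fully faithful functor is a
triangulated subcategory; finite resolutions and stupid truncations show that it contains everything
(`prop_of_hasResolutionOfLength`). -/

lemma isPullback_of_exists_lift {Q Y W Z : C} {a : Q ⟶ Y} {b : Q ⟶ W} {p : Y ⟶ Z} {h : W ⟶ Z}
    (w : a ≫ p = b ≫ h)
    (hmono : ∀ {T : C} (k : T ⟶ Q), k ≫ a = 0 → k ≫ b = 0 → k = 0)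
    (hlift : ∀ {T : C} (y : T ⟶ Y) (x : T ⟶ W), y ≫ p = x ≫ h → ∃ l : T ⟶ Q, l ≫ a = y ∧ l ≫ b = x) :
    IsPullback a b p h := by
  refine ⟨⟨w⟩, ⟨PullbackCone.IsLimit.mk _
    (fun s => (hlift s.fst s.snd s.condition).choose)
    (fun s => (hlift s.fst s.snd s.condition).choose_spec.1)
    (fun s => (hlift s.fst s.snd s.condition).choose_spec.2)
    (fun s m h₁ h₂ => ?_)⟩⟩
  have h := (hlift s.fst s.snd s.condition).choose_spec
  rw [← sub_eq_zero]
  apply hmono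
  · rw [Preadditive.sub_comp, h₁, h.1, sub_self]
  · rw [Preadditive.sub_comp, h₂, h.2, sub_self]

lemma isKernelCokernelPair_iff (S : ShortComplex C) :
    IsKernelCokernelPair S ↔
      (Mono S.f ∧ ∀ {W : C} (k : W ⟶ S.X₂), k ≫ S.g = 0 → ∃ l, l ≫ S.f = k) ∧
        (Epi S.g ∧ ∀ {W : C} (k : S.X₂ ⟶ W), S.f ≫ k = 0 → ∃ l, S.g ≫ l = k) := by
  constructor
  · rintro ⟨⟨h⟩, ⟨h'⟩⟩
    refine ⟨⟨⟨fun k l hkl => Fork.IsLimit.hom_ext h hkl⟩, fun k hk => ?_⟩,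
      ⟨⟨fun k l hkl => Cofork.IsColimit.hom_ext h' hkl⟩, fun k hk => ?_⟩⟩
    · exact ⟨_, (KernelFork.IsLimit.lift' h k hk).2⟩
    · exact ⟨_, (CokernelCofork.IsColimit.desc' h' k hk).2⟩
  · rintro ⟨⟨_, h⟩, ⟨_, h'⟩⟩
    exact ⟨⟨KernelFork.IsLimit.ofι' _ _ fun k hk => ⟨_, (h k hk).choose_spec⟩⟩,
      ⟨CokernelCofork.IsColimit.ofπ' _ _ fun k hk => ⟨_, (h' k hk).choose_spec⟩⟩⟩

variable {conf : ObjectProperty (ShortComplex C)} (hC : IsDeflationExact conf)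

include hC

namespace IsDeflationExact

lemma mono_f {S : ShortComplex C} (hS : conf S) : Mono S.f :=
  ((isKernelCokernelPair_iff S).1 (hC.kernelCokernelPair S hS)).1.1

lemma epi_g {S : ShortComplex C} (hS : conf S) : Epi S.g :=
  ((isKernelCokernelPair_iff S).1 (hC.kernelCokernelPair S hS)).2.1

lemma exists_lift {S : ShortComplex C} (hS : conf S) {W : C} (k : W ⟶ S.X₂) (hk : k ≫ S.g = 0) :
    ∃ l : W ⟶ S.X₁, l ≫ S.f = k :=
  ((isKernelCokernelPair_iff S).1 (hC.kernelCokernelPair S hS)).1.2 k hk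

lemma exists_desc {S : ShortComplex C} (hS : conf S) {W : C} (k : S.X₂ ⟶ W) (hk : S.f ≫ k = 0) :
    ∃ l : S.X₃ ⟶ W, S.g ≫ l = k :=
  ((isKernelCokernelPair_iff S).1 (hC.kernelCokernelPair S hS)).2.2 k hk

lemma conf_of_isKernel {X Y Z : C} (i : X ⟶ Y) (p : Y ⟶ Z) (w : i ≫ p = 0)
    (hp : IsDeflation conf p) [Mono i]
    (hlift : ∀ {W : C} (k : W ⟶ Y), k ≫ p = 0 → ∃ l, l ≫ i = k) :
    conf (ShortComplex.mk i p w) := by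
  obtain ⟨K, j, w', hj⟩ := hp
  have := hC.mono_f hj
  dsimp at this
  obtain ⟨a, ha⟩ := hC.exists_lift hj i w
  obtain ⟨b, hb⟩ := hlift j w'
  dsimp at a ha
  let e : K ≅ X := ⟨b, a, ?_, ?_⟩
  · exact hC.closedUnderIso (ShortComplex.mk j p w') _
      ⟨ShortComplex.isoMk e (Iso.refl _) (Iso.refl _) (by simp [e, hb]) (by simp)⟩ hj
  · rw [← cancel_mono j, Category.assoc, ha, hb, Category.id_comp]
  · rw [← cancel_mono i, Category.assoc, hb, ha, Category.id_comp]

lemma conf_of_isPullback {X Q Y W Z : C} {i : X ⟶ Y} {p : Y ⟶ Z} {w : i ≫ p = 0}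
    (hp : conf (ShortComplex.mk i p w)) {a : Q ⟶ Y} {b : Q ⟶ W} {h : W ⟶ Z}
    (sq : IsPullback a b p h) (i' : X ⟶ Q) (hi' : i' ≫ a = i) (w' : i' ≫ b = 0) :
    conf (ShortComplex.mk i' b w') := by
  have := hC.mono_f hp
  dsimp at this
  have : Mono i' := mono_of_mono_fac hi'
  refine hC.conf_of_isKernel _ _ _ (hC.r2_stable _ _ _ _ sq ⟨X, i, w, hp⟩) fun k hk => ?_
  obtain ⟨l, hl⟩ := hC.exists_lift hp (k ≫ a)
    (by dsimp; rw [Category.assoc, sq.w, reassoc_of% hk, zero_comp])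
  dsimp at l hl
  refine ⟨l, sq.hom_ext ?_ ?_⟩
  · rw [Category.assoc, hi', hl]
  · rw [Category.assoc, w', hk, comp_zero]

/-- The short five lemma, for morphisms of conflations which are identities on the outer terms. -/
lemma isIso_of_conf {X Y Y' Z : C} {i : X ⟶ Y} {p : Y ⟶ Z}
    {w : i ≫ p = 0} {i' : X ⟶ Y'} {p' : Y' ⟶ Z} {w' : i' ≫ p' = 0}
    (h : conf (ShortComplex.mk i p w)) (h' : conf (ShortComplex.mk i' p' w'))
    (g : Y ⟶ Y') (hg : i ≫ g = i') (hg' : g ≫ p' = p) : IsIso g := by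
  have := hC.mono_f h'
  dsimp at this
  -- No pushouts are available, so the inverse of `g` is built on the fibre product `W` of the two
  -- deflations: `a` is the cokernel of `κ = (i, 0)`, and `σ = (1, g)` is the graph of `g`.
  obtain ⟨W, b, a, sq⟩ := hC.r2_exists p p' ⟨X, i, w, h⟩
  let κ : X ⟶ W := sq.lift i 0 (by simp [w])
  have hκb : κ ≫ b = i := by simp [κ]
  have hκa : κ ≫ a = 0 := by simp [κ]
  have hκ : conf (ShortComplex.mk κ a hκa) := hC.conf_of_isPullback h sq κ hκb hκa
  have := hC.epi_g hκ
  dsimp at this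
  let σ : Y ⟶ W := sq.lift (𝟙 Y) g (by simp [hg'])
  have hσb : σ ≫ b = 𝟙 Y := by simp [σ]
  have hσa : σ ≫ a = g := by simp [σ]
  obtain ⟨m, hm⟩ := hC.exists_lift h' (a - b ≫ g) (by
    dsimp
    rw [Preadditive.sub_comp, Category.assoc, hg', sq.w, sub_self])
  dsimp at m hm
  have hκm : κ ≫ m = - 𝟙 X := by
    rw [← cancel_mono i', Category.assoc, hm, Preadditive.comp_sub, hκa, reassoc_of% hκb, hg]
    simp
  have hσm : σ ≫ m = 0 := by
    rw [← cancel_mono i', Category.assoc, hm, Preadditive.comp_sub, hσa, reassoc_of% hσb]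
    simp
  -- The correction `m ≫ i` turns `b` into a map vanishing on `κ`, hence one that descends along
  -- `a`; since `m` vanishes on the graph `σ`, the descended map inverts `g`.
  obtain ⟨s, hs⟩ := hC.exists_desc hκ (b + m ≫ i) (by
    dsimp
    rw [Preadditive.comp_add, hκb, reassoc_of% hκm]
    simp)
  dsimp at s hs
  refine ⟨s, ?_, ?_⟩
  · rw [← hσa, Category.assoc, hs, Preadditive.comp_add, reassoc_of% hσm, hσb]
    simp
  · rw [← cancel_epi a, reassoc_of% hs, Preadditive.add_comp, Category.assoc, hg, hm]
    simp

lemma isDeflation_of_isIso [HasZeroObject C] {X Y : C} (f : X ⟶ Y) [IsIso f] :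
    IsDeflation conf f :=
  hC.r2_stable (0 : X ⟶ 0) f (0 : (0 : C) ⟶ 0) 0 (IsPullback.of_vert_isIso ⟨by simp⟩)
    (hC.r0 _ (isZero_zero C))

/-- If `W` is a pullback of a deflation `b : Y ⟶ P` along `x : X ⟶ P` and `M` is a direct sum
of `Y` and `X`, then `W ⟶ M ⟶ P` is a conflation. -/
lemma conf_of_isPullback_of_biprod [HasZeroObject C] [HasBinaryBiproducts C]
    {X Y P W M : C}
    {π : W ⟶ X} {q : W ⟶ Y} {x : X ⟶ P} {b : Y ⟶ P} (sq : IsPullback π q x b)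
    (hb : IsDeflation conf b)
    (fst : M ⟶ Y) (snd : M ⟶ X) (inl : Y ⟶ M) (inr : X ⟶ M)
    (inl_fst : inl ≫ fst = 𝟙 Y) (inl_snd : inl ≫ snd = 0) (inr_fst : inr ≫ fst = 0)
    (inr_snd : inr ≫ snd = 𝟙 X) (total : fst ≫ inl + snd ≫ inr = 𝟙 M)
    (i : W ⟶ M) (p : M ⟶ P) (hi : i = - q ≫ inl + π ≫ inr) (hp : p = fst ≫ b + snd ≫ x)
    (w : i ≫ p = 0) : conf (ShortComplex.mk i p w) := by
  have hom_ext : ∀ {T : C} {k l : T ⟶ M}, k ≫ fst = l ≫ fst → k ≫ snd = l ≫ snd → k = l := by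
    intro T k l h₁ h₂
    rw [← Category.comp_id k, ← Category.comp_id l, ← total, Preadditive.comp_add,
      Preadditive.comp_add, reassoc_of% h₁, reassoc_of% h₂]
  have hi₁ : i ≫ fst = - q := by simp [hi, inl_fst, inr_fst]
  have hi₂ : i ≫ snd = π := by simp [hi, inl_snd, inr_snd]
  have hmono : Mono i := by
    refine Preadditive.mono_of_cancel_zero _ fun {T} k hk => sq.hom_ext ?_ ?_
    · rw [← hi₂, reassoc_of% hk]; simp
    · rw [← neg_neg q, ← hi₁, Preadditive.comp_neg, reassoc_of% hk]; simp
  refine hC.conf_of_isKernel i p w ?_ fun {T} k hk => ?_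
  -- Up to a base change, `p` is `b ⊕ 1` followed by `(1, x)`. The latter is a sheared projection,
  -- that is, a pullback of `X ⟶ 0`; the former is a pullback of `b`.
  · have h₁ : IsDeflation conf (biprod.desc (𝟙 P) x) := by
      refine hC.r2_stable (biprod.snd : P ⊞ X ⟶ X) (biprod.desc (𝟙 P) x) (0 : X ⟶ (0 : C)) 0
        (isPullback_of_exists_lift (by simp) ?_ ?_) (hC.r0 _ (isZero_zero C))
      · intro T k hk₁ hk₂
        ext
        · simpa [biprod.desc_eq, reassoc_of% hk₁] using hk₂
        · simpa using hk₁
      · intro T y z _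
        exact ⟨biprod.lift (z - y ≫ x) y, by simp, by simp⟩
    have h₂ : IsDeflation conf (biprod.lift (fst ≫ b) snd) := by
      refine hC.r2_stable fst _ b biprod.fst (isPullback_of_exists_lift (by simp) ?_ ?_) hb
      · intro T k hk₁ hk₂
        refine hom_ext (by simpa using hk₁) ?_
        simpa using hk₂ =≫ biprod.snd
      · intro T y z hz
        refine ⟨y ≫ inl + (z ≫ biprod.snd) ≫ inr, by simp [inl_fst, inr_fst], ?_⟩
        ext
        · simp [reassoc_of% inl_fst, reassoc_of% inr_fst, hz]
        · simp [inl_snd, inr_snd]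
    have : p = biprod.lift (fst ≫ b) snd ≫ biprod.desc (𝟙 P) x := by simp [hp]
    rw [this]
    exact hC.r1 _ _ h₂ h₁
  · refine ⟨sq.lift (k ≫ snd) (- k ≫ fst) ?_, hom_ext ?_ ?_⟩
    · rw [hp, Preadditive.comp_add] at hk
      rw [Category.assoc, Preadditive.neg_comp, Category.assoc]
      exact eq_neg_of_add_eq_zero_right hk
    · simp [hi₁]
    · simp [hi₂]

end IsDeflationExact

end Elementary

/-! ### The deflation-exact structure on the subcategory -/

section FullSubcategories

variable {E : Type u} [Category.{v} E] [Preadditive E] {conf : ObjectProperty (ShortComplex E)}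
  (A : ObjectProperty E)

lemma subConflation_mk {K Y Z : A.FullSubcategory} (i : K ⟶ Y) (p : Y ⟶ Z) (w : i ≫ p = 0)
    (h : conf (ShortComplex.mk (A.ι.map i) (A.ι.map p) (by rw [← A.ι.map_comp, w, A.ι.map_zero])))
    (h' : ∀ (D : A.FullSubcategory) (h : D ⟶ Z),
      ∃ (Q : A.FullSubcategory) (a : Q ⟶ Y) (b : Q ⟶ D),
        IsPullback (A.ι.map a) (A.ι.map b) (A.ι.map p) (A.ι.map h)) :
    subConflation conf A (ShortComplex.mk i p w) := ⟨h, h'⟩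

/-- The pullback in `E` already lies in `A`, so it is also the pullback in `A`, and any other
pullback in `A` is isomorphic to it. -/
lemma isPullback_map_of_subConflation {K Q Y Z W : A.FullSubcategory} {i : K ⟶ Y} {p : Y ⟶ Z}
    {w : i ≫ p = 0} (hp : subConflation conf A (ShortComplex.mk i p w))
    {a : Q ⟶ Y} {b : Q ⟶ W} {h : W ⟶ Z} (sq : IsPullback a b p h) :
    IsPullback (A.ι.map a) (A.ι.map b) (A.ι.map p) (A.ι.map h) := by
  obtain ⟨Q', a', b', sq'⟩ := hp.2 W h
  have sq'' : IsPullback a' b' p h := IsPullback.of_map A.ι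
    (A.ι.map_injective (by simpa using sq'.w)) sq'
  refine sq'.of_iso (A.ι.mapIso (sq''.isoIsPullback _ _ sq)) (Iso.refl _) (Iso.refl _)
    (Iso.refl _) ?_ ?_ ?_ ?_
  · simp only [Functor.mapIso_hom, Iso.refl_hom, Category.comp_id, ← Functor.map_comp,
      IsPullback.isoIsPullback_hom_fst]
  · simp only [Functor.mapIso_hom, Iso.refl_hom, Category.comp_id, ← Functor.map_comp,
      IsPullback.isoIsPullback_hom_snd]
  · simp
  · simp

variable (hE : IsDeflationExact conf)

include hE

theorem isDeflationExact_subConflation [HasZeroObject A.FullSubcategory]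
    [HasBinaryBiproducts A.FullSubcategory] :
    IsDeflationExact (subConflation conf A) where
  kernelCokernelPair S hS := by
    obtain ⟨⟨h₁, h₂⟩, h₃, h₄⟩ := (isKernelCokernelPair_iff _).1 (hE.kernelCokernelPair _ hS.1)
    refine (isKernelCokernelPair_iff _).2 ⟨⟨A.ι.mono_of_mono_map h₁, fun k hk => ?_⟩,
      ⟨A.ι.epi_of_epi_map h₃, fun k hk => ?_⟩⟩
    · obtain ⟨l, hl⟩ := h₂ (A.ι.map k) (A.ι.congr_map hk)
      exact ⟨ObjectProperty.homMk l, A.ι.map_injective hl⟩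
    · obtain ⟨l, hl⟩ := h₄ (A.ι.map k) (A.ι.congr_map hk)
      exact ⟨ObjectProperty.homMk l, A.ι.map_injective hl⟩
  closedUnderIso S T := by
    rintro ⟨e⟩ hS
    refine ⟨hE.closedUnderIso _ _ ⟨A.ι.mapShortComplex.mapIso e⟩ hS.1, fun D h => ?_⟩
    obtain ⟨Q, a, b, sq⟩ := hS.2 D (h ≫ e.inv.τ₃)
    let e₂ : S.X₂ ≅ T.X₂ := ShortComplex.π₂.mapIso e
    let e₃ : S.X₃ ≅ T.X₃ := ShortComplex.π₃.mapIso e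
    refine ⟨Q, a ≫ e₂.hom, b, sq.of_iso (Iso.refl _) (A.ι.mapIso e₂) (Iso.refl _)
      (A.ι.mapIso e₃) ?_ ?_ ?_ ?_⟩
    · simp
    · simp
    · exact A.ι.congr_map e.hom.comm₂₃.symm
    · refine (A.ι.map_comp _ _).symm.trans ((A.ι.congr_map ?_).trans (Category.id_comp _).symm)
      exact (Category.assoc _ _ _).trans
        ((congrArg (h ≫ ·) e₃.inv_hom_id).trans (Category.comp_id h))
  r0 {X Z} f hZ := by
    have hZ' : IsZero (A.ι.obj Z) := A.ι.map_isZero hZ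
    have hf : f = 0 := hZ.eq_of_tgt _ _
    refine ⟨X, 𝟙 X, by simp [hf], subConflation_mk A _ _ _ ?_ fun D h => ?_⟩
    · have : Mono (A.ι.map (𝟙 X)) := by rw [A.ι.map_id]; infer_instance
      exact hE.conf_of_isKernel _ _ _ (hE.r0 _ hZ') fun k _ => ⟨k, by
        rw [A.ι.map_id]; exact Category.comp_id _⟩
    -- Over a zero object the pullback is a product, and the additive inclusion carries the
    -- biproduct formed in `A` to one in `E`.
    · refine ⟨X ⊞ D, biprod.fst, biprod.snd, isPullback_of_exists_lift (hZ'.eq_of_tgt _ _) ?_ ?_⟩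
      · intro T k h₁ h₂
        have e : k = (k ≫ A.ι.map biprod.fst) ≫ A.ι.map biprod.inl +
            (k ≫ A.ι.map biprod.snd) ≫ A.ι.map biprod.inr := by
          rw [Category.assoc, Category.assoc, ← A.ι.map_comp, ← A.ι.map_comp,
            ← Preadditive.comp_add, ← A.ι.map_add, biprod.total, A.ι.map_id, Category.comp_id]
        rw [e, h₁, h₂, zero_comp, zero_comp, add_zero]
      · intro T y x _
        refine ⟨y ≫ A.ι.map biprod.inl + x ≫ A.ι.map biprod.inr, ?_, ?_⟩
        · rw [Preadditive.add_comp, Category.assoc, Category.assoc, ← A.ι.map_comp,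
            ← A.ι.map_comp, biprod.inl_fst, biprod.inr_fst, A.ι.map_zero, A.ι.map_id, comp_zero,
            add_zero, Category.comp_id]
        · rw [Preadditive.add_comp, Category.assoc, Category.assoc, ← A.ι.map_comp,
            ← A.ι.map_comp, biprod.inl_snd, biprod.inr_snd, A.ι.map_zero, A.ι.map_id, comp_zero,
            zero_add, Category.comp_id]
  r1 {X Y Z} p q := by
    rintro ⟨K, i, w, hp⟩ ⟨L, j, w', hq⟩
    have : Mono (A.ι.map j) := hE.mono_f hq.1
    -- The kernel of `p ≫ q` is the pullback of `p` along the kernel of `q`; it belongs to `A`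
    -- because `p` comes from an `A`-conflation.
    obtain ⟨Q, a, b, sq⟩ := hp.2 L j
    change IsPullback (A.ι.map a) (A.ι.map b) (A.ι.map p) (A.ι.map j) at sq
    have hw : A.ι.map a ≫ A.ι.map p ≫ A.ι.map q = 0 := by
      rw [sq.w_assoc, ← A.ι.map_comp, w', A.ι.map_zero, comp_zero]
    have : Mono (A.ι.map a) := by
      refine Preadditive.mono_of_cancel_zero _ fun k hk => sq.hom_ext (by simpa using hk) ?_
      rw [← cancel_mono (A.ι.map j), Category.assoc, ← sq.w, reassoc_of% hk]
      simp
    refine ⟨Q, a, A.ι.map_injective (by simpa using hw), subConflation_mk A _ _ _ ?_ fun D h => ?_⟩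
    · simp only [A.ι.map_comp]
      refine hE.conf_of_isKernel _ _ _ (hE.r1 _ _ ⟨_, _, _, hp.1⟩ ⟨_, _, _, hq.1⟩) fun k hk => ?_
      obtain ⟨l, hl⟩ := hE.exists_lift hq.1 (k ≫ A.ι.map p)
        ((Category.assoc _ _ _).trans hk)
      exact ⟨sq.lift k l hl.symm, sq.lift_fst _ _ _⟩
    · obtain ⟨Q₁, a₁, b₁, sq₁⟩ := hq.2 D h
      obtain ⟨Q₂, a₂, b₂, sq₂⟩ := hp.2 Q₁ a₁
      refine ⟨Q₂, a₂, b₂ ≫ b₁, ?_⟩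
      rw [A.ι.map_comp]
      exact (sq₂.flip.paste_horiz sq₁.flip).flip
  r2_exists {Y Z W} p h := by
    rintro ⟨K, i, w, hp⟩
    obtain ⟨Q, a, b, sq⟩ := hp.2 W h
    exact ⟨Q, a, b, IsPullback.of_map A.ι (A.ι.map_injective (by simpa using sq.w)) sq⟩
  r2_stable {Q Y Z W} a b p h sq := by
    rintro ⟨K, i, w, hp⟩
    have sq' := isPullback_map_of_subConflation A hp sq
    let i' : K ⟶ Q := sq.lift i 0 (by simp [w])
    have hi' : i' ≫ a = i := by simp [i']
    have w' : i' ≫ b = 0 := by simp [i']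
    refine ⟨K, i', w', subConflation_mk A _ _ _ ?_ fun D h' => ?_⟩
    · exact hE.conf_of_isPullback hp.1 sq' _ (by rw [← A.ι.map_comp, hi']) _
    · obtain ⟨Q'', a'', b'', sq''⟩ := hp.2 D (h' ≫ h)
      dsimp at sq''
      have w₃ : a'' ≫ p = (b'' ≫ h') ≫ h := A.ι.map_injective (by simpa using sq''.w)
      refine ⟨Q'', sq.lift a'' (b'' ≫ h') w₃, b'', ?_⟩
      refine (IsPullback.of_right (v₁₃ := A.ι.map p) (h₁₂ := A.ι.map a) (h₂₂ := A.ι.map h)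
        ?_ ?_ sq')
      · rw [← A.ι.map_comp, ← A.ι.map_comp, sq.lift_fst]
        exact sq''
      · rw [← A.ι.map_comp, ← A.ι.map_comp, sq.lift_snd]

/-- The comparison from the pullback in `A` to the pullback in `E` is a morphism of conflations of
`E` that is the identity on kernel and cokernel, so the short five lemma applies. -/
theorem isGreatest_subConflation [HasZeroObject A.FullSubcategory]
    [HasBinaryBiproducts A.FullSubcategory] :
    IsGreatest {confA : ObjectProperty (ShortComplex A.FullSubcategory) |
      IsDeflationExact confA ∧ IsConflationExact A.ι confA conf} (subConflation conf A) := by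
  refine ⟨⟨isDeflationExact_subConflation A hE, isConflationExact_ι conf A⟩, ?_⟩
  rintro confA ⟨hA, hA'⟩ S hS
  refine ⟨hA' _ hS, fun D h => ?_⟩
  obtain ⟨Q, a, b, sq⟩ := hA.r2_exists S.g h ⟨_, _, _, hS⟩
  have hi := sq.lift_fst S.f 0 (by simp)
  have hi' := sq.lift_snd S.f 0 (by simp)
  have hQ := hA' _ (hA.conf_of_isPullback (i := S.f) (w := S.zero) hS sq _ hi hi')
  obtain ⟨Q', a', b', sq'⟩ := hE.r2_exists (A.ι.map S.g) (A.ι.map h) ⟨_, _, _, hA' _ hS⟩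
  have hQ' := hE.conf_of_isPullback (hA' _ hS) sq' _
    (sq'.lift_fst (A.ι.map S.f) 0 (by rw [← A.ι.map_comp, S.zero]; simp)) (sq'.lift_snd _ _ _)
  have w : A.ι.map a ≫ A.ι.map S.g = A.ι.map b ≫ A.ι.map h := A.ι.congr_map sq.w
  have := hE.isIso_of_conf hQ hQ' (sq'.lift _ _ w) (sq'.hom_ext (by
      rw [Category.assoc, sq'.lift_fst, sq'.lift_fst]
      exact A.ι.congr_map hi) (by
      rw [Category.assoc, sq'.lift_snd, sq'.lift_snd]
      exact A.ι.congr_map hi')) (sq'.lift_snd _ _ w)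
  refine ⟨Q, a, b, sq'.of_iso (asIso (sq'.lift _ _ w)).symm (Iso.refl _) (Iso.refl _)
    (Iso.refl _) ?_ ?_ ?_ ?_⟩
  all_goals simp

end FullSubcategories

/-! ### Resolutions with acyclic cone -/

/-- Descending recursion: a family of types indexed by `ℤ` which is inhabited in large degrees
and such that any element in degree `i + 1` has a successor in degree `i`. -/
lemma exists_descending_sequence {Stage : ℤ → Type*} (R : ∀ i, Stage (i + 1) → Stage i → Prop)
    (n : ℤ) (base : ∀ i, n ≤ i → Stage i)
    (hbase : ∀ i (hi : n ≤ i), R i (base (i + 1) (by lia)) (base i hi))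
    (step : ∀ i, i < n → ∀ s, ∃ t, R i s t) :
    ∃ s : ∀ i, Stage i, (∀ i (hi : n ≤ i), s i = base i hi) ∧ ∀ i, R i (s (i + 1)) (s i) := by
  choose f hf using step
  -- Here `k` is a budget of recursion steps, enough to climb from `i` to `n`. The sequence spends
  -- exactly `(n - i).toNat` steps at `i`, so below `n` consecutive values are related by one use of
  -- `f`.
  let t : ∀ (k : ℕ) (i : ℤ), n ≤ i + k → Stage i := fun k => Nat.rec
    (fun i hi => base i (by simpa using hi))
    (fun k t i hi => if h : i < n then f i h (t (i + 1) (by push_cast at hi; lia))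
      else base i (by lia)) k
  have ht : ∀ k i hi, t (k + 1) i hi = if h : i < n then f i h (t k (i + 1)
      (by push_cast at hi; lia)) else base i (by lia) :=
    fun _ _ _ => rfl
  have ht' : ∀ k i hi (hi' : n ≤ i), t k i hi = base i hi' := by
    rintro (_ | k) i hi hi'
    · rfl
    · exact (ht k i hi).trans (dif_neg (by lia))
  refine ⟨fun i => t (n - i).toNat i (by lia), fun i hi => ht' _ _ _ hi, fun i => ?_⟩
  dsimp only
  rcases lt_or_ge i n with hi | hi'
  · have : ∀ k (hk : k = (n - (i + 1)).toNat + 1),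
        R i (t (n - (i + 1)).toNat (i + 1) (by lia)) (t k i (by lia)) := by
      rintro _ rfl
      have := hf i hi (t (n - (i + 1)).toNat (i + 1) (by lia))
      convert this using 1
      exact (ht _ i (by lia)).trans (dif_pos hi)
    exact this (n - i).toNat (by omega)
  · have h₁ := ht' (n - i).toNat i (by lia) hi'
    have h₂ := ht' (n - (i + 1)).toNat (i + 1) (by lia) (by lia)
    rw [h₁, h₂]
    exact hbase i hi'

/-- Each pullback square gives a conflation from `P i` to `P (i + 1)` with middle term the degree
`i` part of the cone; the remaining identities say that these splice to the differential of the
cone. -/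
lemma IsDeflationExact.isAcyclic_mappingCone {C : Type u} [Category.{v} C] [Preadditive C]
    [HasZeroObject C] [HasBinaryBiproducts C] {conf : ObjectProperty (ShortComplex C)}
    (hC : IsDeflationExact conf) {X Y : CochainComplex C ℤ} (t : Y ⟶ X) (P : ℤ → C)
    (π : ∀ i, P i ⟶ X.X i) (q : ∀ i, P i ⟶ Y.X (i + 1)) (b : ∀ i, Y.X i ⟶ P i)
    (x : ∀ i, X.X i ⟶ P (i + 1)) (sq : ∀ i, IsPullback (π i) (q i) (x i) (b (i + 1)))
    (hb : ∀ i, IsDeflation conf (b i)) (hY : ∀ i, b i ≫ q i = Y.d i (i + 1))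
    (hX : ∀ i, x i ≫ π (i + 1) = X.d i (i + 1)) (hxq : ∀ i, x i ≫ q (i + 1) = 0)
    (ht : ∀ i, b i ≫ π i = t.f i) : IsAcyclic conf (CochainComplex.mappingCone t) := by
  let p : ∀ i, (CochainComplex.mappingCone t).X i ⟶ P (i + 1) := fun i =>
    (CochainComplex.mappingCone.fst t).1.v i (i + 1) rfl ≫ b (i + 1) +
      (CochainComplex.mappingCone.snd t).v i i (add_zero i) ≫ x i
  let j : ∀ i, P i ⟶ (CochainComplex.mappingCone t).X i := fun i =>
    - q i ≫ (CochainComplex.mappingCone.inl t).v (i + 1) i (by lia) +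
      π i ≫ (CochainComplex.mappingCone.inr t).f i
  have hd : ∀ i, q i ≫ b (i + 1) = π i ≫ x i := fun i => (sq i).w.symm
  refine ⟨P, j, p, fun i => ?_, fun i => ?_⟩
  · have w : j i ≫ p i = 0 := by
      simp [j, p, hd]
    exact ⟨w, hC.conf_of_isPullback_of_biprod (sq i) (hb (i + 1)) _ _ _ _
      (CochainComplex.mappingCone.inl_v_fst_v t _ _ _)
      (CochainComplex.mappingCone.inl_v_snd_v t _ _ _)
      (CochainComplex.mappingCone.inr_f_fst_v t _ _ _)
      (CochainComplex.mappingCone.inr_f_snd_v t _)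
      (CochainComplex.mappingCone.id_X t _ _ _) _ _ rfl rfl _⟩
  · rw [CochainComplex.mappingCone.ext_to_iff _ (i + 1) (i + 1 + 1) rfl,
      CochainComplex.mappingCone.d_fst_v _ _ _ _ rfl, CochainComplex.mappingCone.d_snd_v _ _ _ rfl]
    constructor
    · simp [j, p, hxq, hY]
    · simp [j, p, hX, ht]

section Resolution

variable {C : Type u} [Category.{v} C] [Preadditive C] {conf : ObjectProperty (ShortComplex C)}
  {E : Type u'} [Category.{v'} E] [Preadditive E] (G : C ⥤ E) [G.Additive]
  {X : CochainComplex C ℤ} {N : CochainComplex E ℤ} (g : ∀ i, G.obj (X.X i) ⟶ N.X i)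

/-- A stage of the construction of a resolution `Y ⟶ X` such that the composition
`G Y ⟶ G X ⟶ N` is homotopic to zero. -/
structure ResolutionStage (i : ℤ) where
  P : C
  π : P ⟶ X.X i
  u (j : ℤ) : X.X j ⟶ P
  u_π (j : ℤ) : u j ≫ π = X.d j i
  d_u (j k : ℤ) : X.d j k ≫ u k = 0
  φ : G.obj P ⟶ N.X i
  u_φ (j : ℤ) : G.map (u j) ≫ φ = G.map (X.d j i) ≫ g i
  φ_d (k : ℤ) : φ ≫ N.d i k = 0
  Y : C
  b : Y ⟶ P
  h (j : ℤ) : G.obj Y ⟶ N.X j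
  h_d (j : ℤ) (hj : j + 1 = i) : h j ≫ N.d j i = G.map b ≫ φ

variable {G}

/-- Two consecutive stages are compatible if the second is obtained from the first by a
pullback. -/
def ResolutionStage.IsNext {g : ∀ i, G.obj (X.X i) ⟶ N.X i} {i : ℤ}
    (s : ResolutionStage G g (i + 1)) (t : ResolutionStage G g i) (q : t.P ⟶ s.Y) : Prop :=
  IsPullback t.π q (s.u i) s.b ∧ (∀ j, t.u j ≫ q = 0) ∧
    t.φ = G.map t.π ≫ g i - G.map q ≫ s.h i

variable (hC : IsDeflationExact conf)

include hC in
/-- Let `f : G X ⟶ N` be a morphism of complexes, with `X` bounded above. If sufficiently many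
morphisms to cycles of `N` lift along deflations, there is a morphism `s : Y ⟶ X` with
acyclic cone such that `G s ≫ f` is homotopic to zero. -/
theorem exists_resolution (f : (G.mapHomologicalComplex _).obj X ⟶ N) [HasZeroObject C]
    [HasBinaryBiproducts C] (n : ℤ) [X.IsStrictlyLE n]
    (good : ObjectProperty C) (hgood : ∃ Z, IsZero Z ∧ good Z) (c : ℤ → Prop)
    (hlift : ∀ (j i : ℤ), j + 1 = i → ∀ (P : C) (φ : G.obj P ⟶ N.X i), (∀ k, φ ≫ N.d i k = 0) →
      ∃ (Y : C) (b : Y ⟶ P) (h : G.obj Y ⟶ N.X j), IsDeflation conf b ∧ good Y ∧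
        h ≫ N.d j i = G.map b ≫ φ ∧ (c i → IsIso b)) :
    ∃ (Y : CochainComplex C ℤ) (s : Y ⟶ X), Y.IsStrictlyLE n ∧ (∀ i, good (Y.X i)) ∧
      IsAcyclic conf (CochainComplex.mappingCone s) ∧
      Nonempty (Homotopy ((G.mapHomologicalComplex _).map s ≫ f) 0) ∧
      (∀ i, c (i + 1) → c i → IsZero (X.X i) → IsZero (Y.X i)) := by
  let g : ∀ i, G.obj (X.X i) ⟶ N.X i := f.f
  have hg : ∀ i j, g i ≫ N.d i j = G.map (X.d i j) ≫ g j := fun i j => f.comm i j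
  have key : ∃ s : ∀ i, ResolutionStage G g i, (∀ i, n + 1 ≤ i → IsZero (s i).Y) ∧
      (∀ i, ∃ q, (s (i + 1)).IsNext (s i) q) ∧ ∀ i, IsDeflation conf (s i).b ∧ good (s i).Y ∧
        (c i → IsIso (s i).b) := by
    obtain ⟨Z, hZ, hZ'⟩ := hgood
    let Stage (i : ℤ) := { s : ResolutionStage G g i // IsDeflation conf s.b ∧ good s.Y ∧
        (c i → IsIso s.b) }
    have hX : ∀ i, n + 1 ≤ i → IsZero (X.X i) := fun i hi => X.isZero_of_isStrictlyLE n i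
    -- Above degree `n` everything is zero; `b` is then invertible, as the condition `c` requires in
    -- case it holds there.
    let base : ∀ i, n + 1 ≤ i → Stage i := fun i hi =>
      ⟨{ P := Z, π := 0, u := 0, φ := 0, Y := Z, b := 0, h := 0,
         u_π := fun j => (hX i hi).eq_of_tgt _ _, d_u := by simp, φ_d := by simp,
         u_φ := fun j => by
          rw [(hX i hi).eq_of_tgt (X.d j i) 0]
          simp only [Pi.zero_apply, G.map_zero, zero_comp]
         h_d := by simp },
        hC.r0 _ hZ, hZ', fun _ => ⟨0, hZ.eq_of_src _ _, hZ.eq_of_src _ _⟩⟩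
    obtain ⟨s, hs, hs'⟩ := exists_descending_sequence (Stage := Stage)
      (fun i s t => ∃ q, s.1.IsNext t.1 q) (n + 1) base
      (fun i hi => ⟨0, isPullback_of_exists_lift (hZ.eq_of_tgt _ _)
        (fun _ _ _ => hZ.eq_of_tgt _ _)
        (fun _ _ _ => ⟨0, (hX i hi).eq_of_tgt _ _, hZ.eq_of_tgt _ _⟩), by simp [base],
        (G.map_isZero hZ).eq_of_src _ _⟩) (fun i _ s => by
          obtain ⟨s, hb, -, -⟩ := s
          obtain ⟨Q, q, π, sq⟩ := hC.r2_exists s.b (s.u i) hb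
          have hu : ∀ j, sq.lift 0 (X.d j i) (by simp [s.d_u]) ≫ π = X.d j i := fun j =>
            sq.lift_snd _ _ _
          have hu' : ∀ j, sq.lift 0 (X.d j i) (by simp [s.d_u]) ≫ q = 0 := fun j =>
            sq.lift_fst _ _ _
          let φ : G.obj Q ⟶ N.X i := G.map π ≫ g i - G.map q ≫ s.h i
          -- Both terms of `φ` acquire the same differential: by the pullback square, the lift `s.h`
          -- contributes the map `s.φ` restricted along `s.u i`, which is `X.d` followed by `g`.
          have hφ : ∀ k, φ ≫ N.d i k = 0 := by
            intro k
            by_cases hk : i + 1 = k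
            · subst hk
              dsimp only [φ]
              rw [Preadditive.sub_comp, Category.assoc, Category.assoc, hg, s.h_d i rfl,
                ← G.map_comp_assoc, ← G.map_comp_assoc, sq.w, G.map_comp_assoc, G.map_comp_assoc,
                s.u_φ]
              exact sub_self _
            · rw [N.shape _ _ hk, comp_zero]
          obtain ⟨Y, b, h, hb, hY, hh, hc⟩ := hlift (i - 1) i (by lia) Q φ hφ
          refine ⟨⟨{
            P := Q
            π := π
            u := fun j => sq.lift 0 (X.d j i) (by simp [s.d_u])
            u_π := hu
            d_u := fun j k => sq.hom_ext (by simp [hu']) (by simp [hu])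
            φ := φ
            u_φ := fun j => by
              dsimp only [φ]
              rw [Preadditive.comp_sub, ← G.map_comp_assoc, ← G.map_comp_assoc, hu, hu',
                G.map_zero, zero_comp, sub_zero]
            φ_d := hφ
            Y := Y
            b := b
            -- Only the component in degree `i - 1` matters; the family is indexed by all degrees to
            -- avoid transporting along equalities of integers.
            h := fun j => if hj : j = i - 1 then h ≫ (N.XIsoOfEq hj).inv else 0
            h_d := by
              rintro j hj
              obtain rfl : j = i - 1 := by lia
              simpa using hh }, hb, hY, hc⟩, q, sq.flip, hu', rfl⟩)
    refine ⟨fun i => (s i).1, fun i hi => ?_, hs', fun i => (s i).2⟩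
    dsimp only
    rw [hs i hi]
    exact hZ
  obtain ⟨s, hs, hq, hs'⟩ := key
  choose q hq using hq
  have hb := fun i => (hs' i).1
  have hY := fun i => (hs' i).2.1
  have hc := fun i => (hs' i).2.2
  clear hs'
  have hd : ∀ i, q i ≫ (s (i + 1)).b = (s i).π ≫ (s (i + 1)).u i := fun i => (hq i).1.w.symm
  let Y : CochainComplex C ℤ := CochainComplex.of (fun i => (s i).Y)
    (fun i => (s i).b ≫ q i) (fun i => by
      rw [Category.assoc, reassoc_of% (hd i), (hq (i + 1)).2.1, comp_zero, comp_zero])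
  have hYd : ∀ i, Y.d i (i + 1) = (s i).b ≫ q i :=
    CochainComplex.of_d (fun i => (s i).Y) (fun i => (s i).b ≫ q i)
  let t : Y ⟶ X :=
    { f i := (s i).b ≫ (s i).π
      comm' := by
        rintro i _ rfl
        rw [hYd, Category.assoc, Category.assoc, reassoc_of% (hd i), (s (i + 1)).u_π] }
  refine ⟨Y, t, ?_, hY, ?_, ?_, ?_⟩
  · rw [CochainComplex.isStrictlyLE_iff]
    exact fun i hi => hs i hi
  · exact hC.isAcyclic_mappingCone t (fun i => (s i).P) (fun i => (s i).π) q (fun i => (s i).b)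
      (fun i => (s (i + 1)).u i) (fun i => (hq i).1) hb (fun i => (hYd i).symm)
      (fun i => (s (i + 1)).u_π i) (fun i => (hq (i + 1)).2.1 i) (fun i => rfl)
  · let h : ∀ i j, ((G.mapHomologicalComplex (.up ℤ)).obj Y).X i ⟶ N.X j :=
      fun i j => if j + 1 = i then (s i).h j else 0
    have hh : ∀ i, h (i + 1) i = (s (i + 1)).h i := fun i => if_pos rfl
    refine ⟨{
      hom := h
      zero := fun i j hij => if_neg hij
      comm := fun i => ?_ }⟩
    obtain ⟨j, rfl⟩ : ∃ j, j + 1 = i := ⟨i - 1, by lia⟩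
    rw [dNext_eq _ (show (ComplexShape.up ℤ).Rel (j + 1) (j + 1 + 1) from rfl),
      prevD_eq _ (show (ComplexShape.up ℤ).Rel j (j + 1) from rfl), hh, hh]
    change G.map ((s (j + 1)).b ≫ (s (j + 1)).π) ≫ g (j + 1) =
      G.map (Y.d (j + 1) (j + 1 + 1)) ≫ (s (j + 1 + 1)).h (j + 1) +
        (s (j + 1)).h j ≫ N.d j (j + 1) + 0
    -- The homotopy identity is the lifting property `h_d` with the definition of `φ` substituted.
    rw [(s (j + 1)).h_d _ rfl, (hq (j + 1)).2.2, hYd, Preadditive.comp_sub]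
    simp
  -- Two consecutive degrees are needed: `π` in degree `i` is a base change of `b` in degree `i +
  -- 1`, and then `Y` agrees with `X` through `b` and `π`.
  · intro i hi hi' hX
    have := hc _ hi
    have := hc _ hi'
    have : IsIso (s i).π := (hq i).1.isIso_fst_of_isIso
    exact hX.of_iso (asIso ((s i).b ≫ (s i).π))

end Resolution

/-! ### Criteria for functors between Verdier quotients -/

section VerdierFunctors

variable {T : Type u} [Category.{v} T] [HasZeroObject T] [HasShift T ℤ] [Preadditive T]
  [∀ n : ℤ, (shiftFunctor T n).Additive] [Pretriangulated T]
  {T' : Type u'} [Category.{v'} T'] [HasZeroObject T'] [HasShift T' ℤ] [Preadditive T']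
  [∀ n : ℤ, (shiftFunctor T' n).Additive] [Pretriangulated T']
  {N : ObjectProperty T} {N' : ObjectProperty T'} (G : T ⥤ T') [G.CommShift ℤ]
  [G.IsTriangulated]

lemma essSurj_verdierFunctor (hG : N ≤ N'.inverseImage G)
    (h : ∀ X : T', ∃ (A : T) (s : G.obj A ⟶ X), (thickClosure N').trW s) :
    (verdierFunctor G hG).EssSurj where
  mem_essImage Y := by
    let L := (thickClosure N).trW.Q
    let L' := (thickClosure N').trW.Q
    let e : L ⋙ verdierFunctor G hG ≅ G ⋙ L' := Localization.Lifting.iso _ (thickClosure N).trW _ _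
    have : L'.EssSurj := Localization.essSurj L' (thickClosure N').trW
    obtain ⟨A, s, hs⟩ := h (L'.objPreimage Y)
    have := Localization.inverts L' _ s hs
    exact ⟨L.obj A, ⟨e.app A ≪≫ asIso (L'.map s) ≪≫ L'.objObjPreimageIso Y⟩⟩

variable [IsTriangulated T]

/-- The objects `M` such that any morphism `G A ⟶ M` vanishes after precomposition with the image
of some `A' ⟶ A` whose cone is in `P`. -/
def annihilated (P : ObjectProperty T) : ObjectProperty T' := fun M =>
  ∀ (A : T) (f : G.obj A ⟶ M), ∃ (A' : T) (s : A' ⟶ A), P.trW s ∧ G.map s ≫ f = 0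

instance (P : ObjectProperty T) : (annihilated G P).IsStableUnderRetracts where
  of_retract {X Y} r hY A f := by
    obtain ⟨A', s, hs, h⟩ := hY A (f ≫ r.i)
    refine ⟨A', s, hs, ?_⟩
    simpa using h =≫ r.r

instance (P : ObjectProperty T) [P.IsTriangulated] : (annihilated G P).IsTriangulated where
  exists_zero := ⟨0, isZero_zero _, fun A f => ⟨A, 𝟙 A, P.trW.id_mem A,
    (isZero_zero T').eq_of_tgt _ _⟩⟩
  isStableUnderShiftBy n := ⟨fun M hM A f => by
    obtain ⟨A', s, hs, h⟩ := hM (A⟦-n⟧) ((G.commShiftIso (-n)).hom.app A ≫ f⟦-n⟧' ≫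
      (shiftShiftNeg M n).hom)
    obtain ⟨A₀, ⟨e⟩⟩ : ∃ A₀ : T, Nonempty (A₀⟦-n⟧ ≅ A') :=
      ⟨_, ⟨(shiftFunctor T (-n)).objObjPreimageIso A'⟩⟩
    obtain ⟨s₀, hs₀⟩ := (shiftFunctor T (-n)).map_surjective (e.hom ≫ s)
    refine ⟨A₀, s₀, ?_, (shiftFunctor T' (-n)).map_injective ?_⟩
    · refine ObjectProperty.trW.unshift P (n := -n) ?_
      rw [hs₀]
      exact P.trW.comp_mem _ _ (P.trW_of_isIso _) hs
    · rw [Functor.map_zero, Functor.map_comp, ← cancel_epi ((G.commShiftIso (-n)).hom.app A₀),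
        ← cancel_mono (shiftShiftNeg M n).hom, comp_zero, zero_comp]
      have := G.commShiftIso_hom_naturality s₀ (-n)
      rw [Category.assoc, Category.assoc, ← reassoc_of% this, hs₀, G.map_comp, Category.assoc, h,
        comp_zero]⟩
  toIsTriangulatedClosed₂ := .mk' (fun D hD h₁ h₃ A f => by
    -- Once the composite to the third vertex is killed, the map factors through the first vertex,
    -- where it is killed by a second refinement.
    obtain ⟨A', s, hs, h⟩ := h₃ A (f ≫ D.mor₂)
    obtain ⟨k, hk⟩ := Triangle.coyoneda_exact₂ _ hD (G.map s ≫ f) (by simpa using h)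
    obtain ⟨A'', s', hs', h'⟩ := h₁ A' k
    exact ⟨A'', s' ≫ s, P.trW.comp_mem _ _ hs' hs, by
      rw [G.map_comp, Category.assoc, hk, reassoc_of% h', zero_comp]⟩)

variable (N N') in
/-- Any morphism from an object in the image of `G` to an object in `N'` factors through the
image of an object in the thick closure of `N`. -/
def FactorsThroughThickClosure : Prop :=
  ∀ (A : T) (M : T'), N' M → ∀ f : G.obj A ⟶ M, ∃ (B : T) (g : A ⟶ B) (h : G.obj B ⟶ M),
    thickClosure N B ∧ f = G.map g ≫ h

variable {G} (H : FactorsThroughThickClosure N N' G)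

include H

namespace FactorsThroughThickClosure

/-- The factorization is assumed only for objects of `N'`. Annihilation follows by taking the fibre
of `A ⟶ B`, and it defines a thick subcategory, so it extends to the whole thick closure. -/
lemma annihilated {M : T'} (hM : thickClosure N' M) : annihilated G (thickClosure N) M := by
  refine hM _ inferInstance inferInstance fun M hM A f => ?_
  obtain ⟨B, g, h, hB, rfl⟩ := H A M hM f
  obtain ⟨A', s, δ, hT⟩ := distinguished_cocone_triangle₁ g
  refine ⟨A', s, ObjectProperty.trW.mk _ hT hB, ?_⟩
  rw [← G.map_comp_assoc, show s ≫ g = 0 from comp_distTriang_mor_zero₁₂ _ hT, G.map_zero,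
    zero_comp]

/-- A map with cone in the thick closure can be refined to one from the source category: kill `G X ⟶
M`, where `M` is the cone of `s`, and lift through `s`. -/
lemma exists_fac {X : T} {Z : T'} (s : Z ⟶ G.obj X) (hs : (thickClosure N').trW s) :
    ∃ (A : T) (t : A ⟶ X) (a : G.obj A ⟶ Z), (thickClosure N).trW t ∧ a ≫ s = G.map t := by
  obtain ⟨M, g, h, hT, hM⟩ := hs
  obtain ⟨A, t, ht, w⟩ := H.annihilated hM X g
  obtain ⟨a, ha⟩ := Triangle.coyoneda_exact₂ _ hT _ w
  exact ⟨A, t, a, ht, ha.symm⟩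

variable [IsTriangulated T'] (hG : N ≤ N'.inverseImage G)

/-- The denominator of a right fraction is replaced by some `G.map t`; the new numerator lies
between objects in the image of `G`, where fullness of `G` applies. -/
lemma full_verdierFunctor [G.Full] : (verdierFunctor G hG).Full := by
  let L := (thickClosure N).trW.Q
  let L' := (thickClosure N').trW.Q
  have : L.EssSurj := Localization.essSurj L (thickClosure N).trW
  let e : L ⋙ verdierFunctor G hG ≅ G ⋙ L' := Localization.Lifting.iso _ (thickClosure N).trW _ _
  refine Functor.full_of_comp_essSurj _ L fun X₁ X₂ φ => ?_
  obtain ⟨φ', rfl⟩ : ∃ φ', φ = e.hom.app X₁ ≫ φ' ≫ e.inv.app X₂ :=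
    ⟨e.inv.app X₁ ≫ φ ≫ e.hom.app X₂, by simp⟩
  obtain ⟨f, hf⟩ := Localization.exists_rightFraction L' (thickClosure N').trW φ'
  obtain ⟨A, t, a, ht, ha⟩ := H.exists_fac f.s f.hs
  obtain ⟨g, hg⟩ := G.map_surjective (a ≫ f.f)
  have := Localization.inverts L _ t ht
  have := Localization.inverts L' _ f.s f.hs
  refine ⟨inv (L.map t) ≫ L.map g, ?_⟩
  rw [← cancel_epi ((verdierFunctor G hG).map (L.map t)), ← Functor.map_comp,
    IsIso.hom_inv_id_assoc]
  have h₁ := e.hom.naturality t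
  have h₂ := e.hom.naturality g
  dsimp at h₁ h₂
  rw [reassoc_of% h₁, ← ha, L'.map_comp, Category.assoc, hf]
  rw [MorphismProperty.RightFraction.map_s_comp_map_assoc, ← L'.map_comp_assoc, ← hg,
    ← reassoc_of% h₂]
  simp

/-- If `G.map f` dies in the quotient, some denominator kills it; refining this to `G.map t` gives
`t ≫ f = 0` by faithfulness of `G`. -/
lemma faithful_verdierFunctor [G.Faithful] : (verdierFunctor G hG).Faithful := by
  let L := (thickClosure N).trW.Q
  let L' := (thickClosure N').trW.Q
  have : L.EssSurj := Localization.essSurj L (thickClosure N).trW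
  let e : L ⋙ verdierFunctor G hG ≅ G ⋙ L' := Localization.Lifting.iso _ (thickClosure N).trW _ _
  have : (verdierFunctor G hG).Additive := by
    rw [Localization.functor_additive_iff L (thickClosure N).trW]
    exact Functor.additive_of_iso e.symm
  refine Functor.faithful_of_comp_cancel_zero_of_hasLeftCalculusOfFractions L
    (thickClosure N).trW _ fun X₁ X₂ f hf => ?_
  replace hf : L'.map (G.map f) = L'.map 0 := by
    have := e.inv.naturality f
    dsimp at this
    rw [L'.map_zero, ← cancel_mono (e.inv.app X₂)]
    dsimp
    rw [this]
    simp [hf]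
  rw [MorphismProperty.map_eq_iff_precomp L' (thickClosure N').trW] at hf
  obtain ⟨Z, s, hs, fac⟩ := hf
  obtain ⟨A, t, a, ht, ha⟩ := H.exists_fac s hs
  have := Localization.inverts L _ t ht
  rw [← cancel_epi (L.map t), ← L.map_comp, comp_zero, ← L.map_zero]
  congr 1
  apply G.map_injective
  rw [G.map_comp, ← ha, Category.assoc, fac, comp_zero, comp_zero, G.map_zero]

end FactorsThroughThickClosure

omit H

variable [IsTriangulated T'] (G) (hG : N ≤ N'.inverseImage G)

/-- The composite with the localization functor is triangulated, and this descends because every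
arrow of the quotient is, up to isomorphism, the image of an arrow. -/
lemma isTriangulated_verdierFunctor : (verdierFunctor G hG).IsTriangulated := by
  let L := (thickClosure N).trW.Q
  let e : L ⋙ verdierFunctor G hG ≅ G ⋙ (thickClosure N').trW.Q :=
    Localization.Lifting.iso _ (thickClosure N).trW _ _
  have := Localization.essSurj_mapArrow L (thickClosure N).trW
  have : NatTrans.CommShift e.hom ℤ := inferInstance
  exact Functor.isTriangulated_of_precomp_iso e

end VerdierFunctors

/-! ### Complexes concentrated in one degree and stupid truncations -/

section HomotopyCategories

variable {C : Type u} [Category.{v} C] [Preadditive C]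

/-- Two complexes concentrated in the same degree are isomorphic if their terms are. -/
lemma nonempty_iso_of_isZero (K L : CochainComplex C ℤ) (k : ℤ) (e : Nonempty (K.X k ≅ L.X k))
    (hK : ∀ i, i ≠ k → IsZero (K.X i)) (hL : ∀ i, i ≠ k → IsZero (L.X i)) :
    Nonempty (K ≅ L) := by
  have h : ∀ i, Nonempty (K.X i ≅ L.X i) := fun i => by
    by_cases hi : i = k
    · subst hi; exact e
    · exact ⟨(hK i hi).iso (hL i hi)⟩
  refine ⟨HomologicalComplex.Hom.isoOfComponents (fun i => (h i).some) fun i j hij => ?_⟩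
  by_cases hi : i = k
  · have hj : j ≠ k := by
      simp only [ComplexShape.up_Rel] at hij
      lia
    exact (hL j hj).eq_of_tgt _ _
  · exact (hK i hi).eq_of_src _ _

variable [HasZeroObject C] [HasBinaryBiproducts C] {conf : ObjectProperty (ShortComplex C)}

lemma trW_thickClosure_acyclicIn (B : ObjectProperty (HomotopyCategory C (.up ℤ)))
    [B.IsTriangulated] {K L : B.FullSubcategory} (f : K ⟶ L) {K' L' : CochainComplex C ℤ}
    (s : K' ⟶ L') (e₁ : K.obj = (HomotopyCategory.quotient _ _).obj K')
    (e₂ : L.obj = (HomotopyCategory.quotient _ _).obj L')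
    (hf : f.hom = eqToHom e₁ ≫ (HomotopyCategory.quotient _ _).map s ≫ eqToHom e₂.symm)
    (hs : IsAcyclic conf (CochainComplex.mappingCone s))
    (hs' : B ((HomotopyCategory.quotient _ _).obj (CochainComplex.mappingCone s))) :
    (acyclicIn B conf).trW f := by
  obtain ⟨K, hK⟩ := K
  obtain ⟨L, hL⟩ := L
  obtain rfl : K = (HomotopyCategory.quotient _ _).obj K' := e₁
  obtain rfl : L = (HomotopyCategory.quotient _ _).obj L' := e₂
  let P : ObjectProperty (HomotopyCategory C (.up ℤ)) := fun K => IsAcyclic conf K.as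
  refine (ObjectProperty.trW_inverseImage_ι_iff B P f).2 ?_
  have : f.hom = (HomotopyCategory.quotient _ _).map s := by simpa using hf
  rw [this]
  exact ⟨_, _, _, HomotopyCategory.mappingCone_triangleh_distinguished s, hs', hs⟩

/-- The stupid truncations of a complex. -/
lemma exists_stupidTruncation_triangle (K : CochainComplex C ℤ) (a : ℤ) :
    ∃ (K₁ K₃ : CochainComplex C ℤ)
      (f : (HomotopyCategory.quotient _ _).obj K₁ ⟶ (HomotopyCategory.quotient _ _).obj K)
      (g : (HomotopyCategory.quotient _ _).obj K ⟶ (HomotopyCategory.quotient _ _).obj K₃)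
      (h : (HomotopyCategory.quotient _ _).obj K₃ ⟶
        ((HomotopyCategory.quotient _ _).obj K₁)⟦(1 : ℤ)⟧),
      Triangle.mk f g h ∈ distTriang _ ∧ (∀ i, i < a → IsZero (K₁.X i)) ∧
      (∀ i, a ≤ i → Nonempty (K₁.X i ≅ K.X i)) ∧ (∀ i, a ≤ i → IsZero (K₃.X i)) ∧
      (∀ i, i < a → Nonempty (K₃.X i ≅ K.X i)) := by
  -- Each term is written as a direct sum `Y ⊕ W` with one summand zero, so that both truncations
  -- have uniform formulas with no case distinction on the degree.
  have : ∀ i, ∃ (Y W : C) (m : Y ⟶ K.X i) (r : K.X i ⟶ Y) (p : K.X i ⟶ W) (s : W ⟶ K.X i),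
      (m ≫ r = 𝟙 Y ∧ s ≫ p = 𝟙 W ∧ m ≫ p = 0 ∧ r ≫ m + p ≫ s = 𝟙 _) ∧
      (i < a → IsZero Y) ∧ (a ≤ i → Nonempty (Y ≅ K.X i)) ∧ (a ≤ i → IsZero W) ∧
      (i < a → Nonempty (W ≅ K.X i)) := fun i => by
    rcases lt_or_ge i a with hi | hi
    · exact ⟨0, K.X i, 0, 0, 𝟙 _, 𝟙 _, by simp, fun _ => isZero_zero _, fun _ => by lia,
        fun _ => by lia, fun _ => ⟨Iso.refl _⟩⟩
    · exact ⟨K.X i, 0, 𝟙 _, 𝟙 _, 0, 0, by simp, fun _ => by lia, fun _ => ⟨Iso.refl _⟩,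
        fun _ => isZero_zero _, fun _ => by lia⟩
  choose Y W m r p s h hY hY' hW hW' using this
  have hmr := fun i => (h i).1
  have hsp := fun i => (h i).2.1
  have hmp := fun i => (h i).2.2.1
  have hid := fun i => (h i).2.2.2
  have hd : ∀ i j, m i ≫ K.d i j ≫ p j = 0 := fun i j => by
    by_cases hij : i + 1 = j
    · rcases lt_or_ge i a with hi | hi
      · exact (hY i hi).eq_of_src _ _
      · exact (hW j (by lia)).eq_of_tgt _ _
    · rw [K.shape _ _ hij, zero_comp, comp_zero]
  have hm : ∀ i j, m i ≫ K.d i j ≫ r j ≫ m j = m i ≫ K.d i j := fun i j => by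
    rw [eq_sub_of_add_eq (hid j), Preadditive.comp_sub, Preadditive.comp_sub,
      reassoc_of% hd i j, zero_comp, sub_zero, Category.comp_id]
  have hp : ∀ i j, p i ≫ s i ≫ K.d i j ≫ p j = K.d i j ≫ p j := fun i j => by
    rw [← Category.assoc (p i), eq_sub_of_add_eq' (hid i), Preadditive.sub_comp, Category.assoc,
      hd i j, comp_zero, sub_zero, Category.id_comp]
  let K₁ : CochainComplex C ℤ :=
    { X := Y
      d i j := m i ≫ K.d i j ≫ r j
      shape i j hij := by simp [K.shape i j hij]
      d_comp_d' i j k _ _ := by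
        rw [Category.assoc, Category.assoc, reassoc_of% hm i j]
        simp }
  let K₃ : CochainComplex C ℤ :=
    { X := W
      d i j := s i ≫ K.d i j ≫ p j
      shape i j hij := by simp [K.shape i j hij]
      d_comp_d' i j k _ _ := by
        rw [Category.assoc, Category.assoc, hp j k]
        simp }
  let f : K₁ ⟶ K :=
    { f := m
      comm' i j _ := by simp [K₁, hm] }
  let g : K ⟶ K₃ :=
    { f := p
      comm' i j _ := by simp [K₃, hp] }
  let S : ShortComplex (CochainComplex C ℤ) := ShortComplex.mk f g (by ext i; exact hmp i)
  let σ : ∀ n, (S.map (HomologicalComplex.eval C _ n)).Splitting := fun n =>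
    { r := r n
      s := s n
      f_r := hmr n
      s_g := hsp n
      id := hid n }
  exact ⟨K₁, K₃, _, _, _,
    (HomotopyCategory.distinguished_iff_iso_trianglehOfDegreewiseSplit _).2 ⟨S, σ, ⟨Iso.refl _⟩⟩,
    hY, hY', hW, hW'⟩

end HomotopyCategories

/-! ### Maps from complexes over the subcategory to acyclic complexes -/

section FullSubcategories

variable {E : Type u} [Category.{v} E] [Preadditive E] {conf : ObjectProperty (ShortComplex E)}
  {A : ObjectProperty E}

lemma isZero_of_isZero_obj {X : A.FullSubcategory} (hX : IsZero X.obj) : IsZero X := by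
  rw [IsZero.iff_id_eq_zero]
  exact A.ι.map_injective (hX.eq_of_src _ _)

/-- A complex whose terms are isomorphic to objects of `A` is isomorphic to a complex in the full
subcategory `A`. -/
lemma exists_iso_mapHomologicalComplex (L : CochainComplex E ℤ)
    (hL : ∀ i, A.isoClosure (L.X i)) :
    ∃ K : CochainComplex A.FullSubcategory ℤ,
      Nonempty ((A.ι.mapHomologicalComplex _).obj K ≅ L) := by
  choose X hX e using hL
  replace e := fun i => (e i).some
  let K : CochainComplex A.FullSubcategory ℤ :=
    { X i := ⟨X i, hX i⟩
      d i j := ObjectProperty.homMk ((e i).inv ≫ L.d i j ≫ (e j).hom)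
      shape i j hij := by
        apply A.ι.map_injective
        simp [L.shape i j hij]
      d_comp_d' i j k _ _ := by
        apply A.ι.map_injective
        simp }
  exact ⟨K, ⟨HomologicalComplex.Hom.isoOfComponents (fun i => (e i).symm) (fun i j _ => by
    change (e i).inv ≫ L.d i j = ((e i).inv ≫ L.d i j ≫ (e j).hom) ≫ (e j).inv
    simp)⟩⟩

lemma isoClosure_of_isZero [HasZeroObject A.FullSubcategory] {X : E} (hX : IsZero X) : A.isoClosure X :=
  ⟨_, (0 : A.FullSubcategory).property, ⟨hX.iso (A.ι.map_isZero (isZero_zero _))⟩⟩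

/-- Axiom `C2'` allows to lift morphisms to cycles of acyclic complexes along deflations. -/
lemma AxiomC2'.exists_lift (hE : IsDeflationExact conf) (hC2' : AxiomC2' conf A)
    {N : CochainComplex E ℤ} (hN : IsAcyclic conf N) (j i : ℤ) (hij : j + 1 = i)
    (P : A.FullSubcategory) (φ : A.ι.obj P ⟶ N.X i) (hφ : ∀ k, φ ≫ N.d i k = 0) :
    ∃ (Y : A.FullSubcategory) (b : Y ⟶ P) (h : A.ι.obj Y ⟶ N.X j),
      IsDeflation (subConflation conf A) b ∧ h ≫ N.d j i = A.ι.map b ≫ φ := by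
  subst hij
  obtain ⟨Z, z, p, hZ, hd⟩ := hN
  have hz : ∀ i, Mono (z i) := fun i => hE.mono_f (hZ i).choose_spec
  obtain ⟨ψ, hψ⟩ := hE.exists_lift (hZ (j + 1)).choose_spec φ (by
    have := hz (j + 1 + 1)
    rw [← cancel_mono (z (j + 1 + 1)), Category.assoc]
    dsimp
    rw [hd, hφ, zero_comp])
  dsimp at ψ hψ
  -- Since `φ` factors through the cycles as `ψ`, pulling back the deflation onto the cycles gives a
  -- conflation ending in `P`, to which C2' applies.
  obtain ⟨Q, a, b, sq⟩ := hE.r2_exists (p j) ψ ⟨_, _, _, (hZ j).choose_spec⟩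
  obtain ⟨X, i, w, hi⟩ := hE.r2_stable _ _ _ _ sq ⟨_, _, _, (hZ j).choose_spec⟩
  obtain ⟨K, B, i', p', w', f, g, hp', -, hg⟩ := hC2' X Q P i b w hi
  refine ⟨B, p', g ≫ a, ⟨_, _, _, hp'⟩, ?_⟩
  rw [← hg, ← hd, ← hψ, Category.assoc, Category.assoc, sq.w_assoc]

variable [HasZeroObject E] [HasBinaryBiproducts E] [HasZeroObject A.FullSubcategory]
  [HasBinaryBiproducts A.FullSubcategory]

variable {B : ObjectProperty (HomotopyCategory A.FullSubcategory (.up ℤ))} [B.IsTriangulated]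
  {B' : ObjectProperty (HomotopyCategory E (.up ℤ))} [B'.IsTriangulated]

/-- The functor between full subcategories of the homotopy categories of `A` and `E`. -/
abbrev mapK (hBB' : ∀ K : B.FullSubcategory, B' ((B.ι ⋙ A.ι.mapHomotopyCategory (.up ℤ)).obj K)) :
    B.FullSubcategory ⥤ B'.FullSubcategory :=
  B'.lift (B.ι ⋙ A.ι.mapHomotopyCategory (.up ℤ)) hBB'

/-- One argument serves both boundedness conditions. The predicate `c` marks degrees where `N`
vanishes: there the lifting problem is trivial and an identity suffices as covering, which is how
lower bounds survive. -/
lemma factorsThroughThickClosure_mapK (hE : IsDeflationExact conf) (hC2' : AxiomC2' conf A)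
    (hBB' : ∀ K : B.FullSubcategory, B' ((B.ι ⋙ A.ι.mapHomotopyCategory (.up ℤ)).obj K))
    (hB : ∀ (X : CochainComplex A.FullSubcategory ℤ) (N : CochainComplex E ℤ),
      B ((HomotopyCategory.quotient _ _).obj X) → B' ((HomotopyCategory.quotient _ _).obj N) →
      ∃ (n : ℤ) (c : ℤ → Prop), X.IsStrictlyLE n ∧ (∀ i, c i → IsZero (N.X i)) ∧
        ∀ Y : CochainComplex A.FullSubcategory ℤ, Y.IsStrictlyLE n →
          (∀ i, c (i + 1) → c i → IsZero (X.X i) → IsZero (Y.X i)) → 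
            B ((HomotopyCategory.quotient _ _).obj Y))
    (hcone : ∀ (X Y : CochainComplex A.FullSubcategory ℤ) (s : Y ⟶ X),
      B ((HomotopyCategory.quotient _ _).obj X) → B ((HomotopyCategory.quotient _ _).obj Y) →
      B ((HomotopyCategory.quotient _ _).obj (CochainComplex.mappingCone s))) :
    FactorsThroughThickClosure (acyclicIn B (subConflation conf A)) (acyclicIn B' conf)
      (mapK hBB') := by
  rintro ⟨X, hX⟩ ⟨N, hN'⟩ hN f
  obtain ⟨X, rfl⟩ := HomotopyCategory.quotient_obj_surjective X
  obtain ⟨N, rfl⟩ := HomotopyCategory.quotient_obj_surjective N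
  replace hN : IsAcyclic conf N := hN
  obtain ⟨n, c, _, hc, hY⟩ := hB X N hX hN'
  obtain ⟨φ, hφ⟩ : ∃ φ : (A.ι.mapHomologicalComplex (.up ℤ)).obj X ⟶ N,
    (HomotopyCategory.quotient _ _).map φ = f.hom := (HomotopyCategory.quotient _ _).map_surjective _
  obtain ⟨Y, s, hYn, -, hs, ⟨hsφ⟩, hYc⟩ := exists_resolution
    (isDeflationExact_subConflation A hE) φ n (fun _ => True) ⟨0, isZero_zero _, trivial⟩ c
    (fun j i hij P ψ hψ => by
      by_cases hi : c i
      · exact ⟨P, 𝟙 P, 0, (isDeflationExact_subConflation A hE).isDeflation_of_isIso _, trivial,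
          (hc i hi).eq_of_tgt _ _, fun _ => inferInstance⟩
      · obtain ⟨Y, b, h, hb, hh⟩ := hC2'.exists_lift hE hN j i hij P ψ hψ
        exact ⟨Y, b, h, hb, trivial, hh, fun hi' => (hi hi').elim⟩)
  replace hY := hY Y hYn hYc
  let X' : B.FullSubcategory := ⟨_, hX⟩
  let Y' : B.FullSubcategory := ⟨_, hY⟩
  let s' : Y' ⟶ X' := ObjectProperty.homMk ((HomotopyCategory.quotient _ _).map s)
  obtain ⟨M, g, h, hT, hM⟩ := trW_thickClosure_acyclicIn B s' s rfl rfl (by simp [s'])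
    hs (hcone _ _ s hX hY)
  -- Since `f` becomes null-homotopic on `Y`, it factors through the image of the cone of `s`, which
  -- is acyclic over `A`.
  obtain ⟨f', hf'⟩ := Triangle.yoneda_exact₂ _ ((mapK hBB').map_distinguished _ hT) f (by
    apply B'.ι.map_injective
    change (HomotopyCategory.quotient _ _).map ((A.ι.mapHomologicalComplex (.up ℤ)).map s) ≫
      f.hom = 0
    rw [← hφ, ← Functor.map_comp, HomotopyCategory.eq_of_homotopy _ _ hsφ, Functor.map_zero])
  exact ⟨M, g, f', le_thickClosure _ _ hM, hf'⟩

end FullSubcategories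

section FullyFaithful

variable {C : Type u} [Category.{v} C] [Preadditive C] {D : Type u'} [Category.{v'} D]
  [Preadditive D] (F : C ⥤ D) [F.Additive] [F.Full] [F.Faithful]

instance : (mapKMinus F).Full :=
  inferInstanceAs ((minus D).lift ((minus C).ι ⋙ F.mapHomotopyCategory (.up ℤ)) _).Full

instance : (mapKMinus F).Faithful :=
  inferInstanceAs ((minus D).lift ((minus C).ι ⋙ F.mapHomotopyCategory (.up ℤ)) _).Faithful

instance : (mapKBounded F).Full :=
  inferInstanceAs ((bounded D).lift ((bounded C).ι ⋙ F.mapHomotopyCategory (.up ℤ)) _).Full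

instance : (mapKBounded F).Faithful :=
  inferInstanceAs ((bounded D).lift ((bounded C).ι ⋙ F.mapHomotopyCategory (.up ℤ)) _).Faithful

end FullyFaithful

/-! ### The derived equivalences -/

section DerivedEquivalences

variable {E : Type u} [Category.{v} E] [Preadditive E] [HasZeroObject E] [HasBinaryBiproducts E]
  {conf : ObjectProperty (ShortComplex E)} {A : ObjectProperty E} [HasZeroObject A.FullSubcategory]

/-- A triangulated subcategory of the homotopy category contains all bounded complexes if it
contains the bounded acyclic complexes and the bounded complexes of objects of `A`, and if all
objects admit finite resolutions by objects in `A`. -/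
lemma prop_of_hasResolutionOfLength (Q : ObjectProperty (HomotopyCategory E (.up ℤ)))
    [Q.IsTriangulated] [Q.IsClosedUnderIsomorphisms]
    (hA : ∀ L : CochainComplex A.FullSubcategory ℤ,
      bounded _ ((HomotopyCategory.quotient _ _).obj L) →
        Q ((HomotopyCategory.quotient _ _).obj ((A.ι.mapHomologicalComplex _).obj L)))
    (hac : ∀ R : CochainComplex E ℤ, IsAcyclic conf R →
      bounded _ ((HomotopyCategory.quotient _ _).obj R) →
        Q ((HomotopyCategory.quotient _ _).obj R))
    (hres : ∀ X, ∃ n, HasResolutionOfLength conf A X n) (K : CochainComplex E ℤ)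
    (hK : bounded _ ((HomotopyCategory.quotient _ _).obj K)) :
    Q ((HomotopyCategory.quotient _ _).obj K) := by
  have h₁ : ∀ K : CochainComplex E ℤ, (∀ i, i ≠ 1 → IsZero (K.X i)) →
      Q ((HomotopyCategory.quotient _ _).obj K) := by
    intro K hK
    obtain ⟨n, R, hR, ⟨e⟩, hRA, hR₀⟩ := hres (K.X 1)
    -- The resolved object sits in degree `1` of `R`, so cutting there separates it from the complex
    -- of objects of `A`; the acyclic `R` is the middle vertex of the triangle.
    obtain ⟨K₁, K₃, f, g, h, hT, hK₁, hK₁', hK₃, hK₃'⟩ := exists_stupidTruncation_triangle R 1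
    obtain ⟨e'⟩ := nonempty_iso_of_isZero K₁ K 1 ⟨(hK₁' 1 le_rfl).some ≪≫ e⟩ (fun i hi => by
      rcases lt_or_gt_of_ne hi with hi | hi
      · exact hK₁ i hi
      · exact (hR₀ i (Or.inr hi)).of_iso (hK₁' i hi.le).some) hK
    have hK₃₀ : ∀ i, i < - (n : ℤ) ∨ 1 ≤ i → IsZero (K₃.X i) := fun i hi => by
      rcases lt_or_ge i 1 with hi' | hi'
      · exact (hR₀ i (Or.inl (by lia))).of_iso (hK₃' i hi').some
      · exact hK₃ i hi'
    obtain ⟨L, ⟨eL⟩⟩ := exists_iso_mapHomologicalComplex (A := A) K₃ (fun i => by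
      by_cases hi : i < - (n : ℤ) ∨ 1 ≤ i
      · exact isoClosure_of_isZero (hK₃₀ i hi)
      · exact ⟨_, hRA i (by lia) (by lia), hK₃' i (by lia)⟩)
    have hL : ∀ i, i < - (n : ℤ) ∨ 1 ≤ i → IsZero (L.X i) := fun i hi =>
      isZero_of_isZero_obj ((hK₃₀ i hi).of_iso ((HomologicalComplex.eval _ _ i).mapIso eL))
    have hQ₃ := Q.prop_of_iso ((HomotopyCategory.quotient _ _).mapIso eL) (hA L
      ⟨- (n : ℤ), 0, (CochainComplex.isStrictlyGE_iff _ _).2 fun i hi => hL i (Or.inl hi),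
        (CochainComplex.isStrictlyLE_iff _ _).2 fun i hi => hL i (Or.inr hi)⟩)
    have hQ₂ := hac R hR
      ⟨- (n : ℤ), 1, (CochainComplex.isStrictlyGE_iff _ _).2 fun i hi => hR₀ i (Or.inl hi),
        (CochainComplex.isStrictlyLE_iff _ _).2 fun i hi => hR₀ i (Or.inr hi)⟩
    exact Q.prop_of_iso ((HomotopyCategory.quotient _ _).mapIso e')
      (Q.ext_of_isTriangulatedClosed₁ _ hT hQ₂ hQ₃)
  have h₂ : ∀ (k : ℤ) (K : CochainComplex E ℤ), (∀ i, i ≠ k → IsZero (K.X i)) →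
      Q ((HomotopyCategory.quotient _ _).obj K) := by
    intro k K hK
    -- Shifting by `k - 1` moves degree `k` to degree `1`.
    rw [← Q.prop_shift_iff_of_isStableUnderShift _ (k - 1), HomotopyCategory.shift_quotient_obj]
    exact h₁ _ fun i hi => hK _ (by lia)
  -- Induction on the width `n` of the support, splitting off the lowest term `m` by a stupid
  -- truncation.
  have h₃ : ∀ (n : ℕ) (m : ℤ) (K : CochainComplex E ℤ),
      (∀ i, i < m ∨ m + n ≤ i → IsZero (K.X i)) →
      Q ((HomotopyCategory.quotient _ _).obj K) := by
    intro n
    induction n with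
    | zero =>
      intro m K hK
      exact h₂ 0 K fun i _ => hK i (by lia)
    | succ n hn =>
      intro m K hK
      obtain ⟨K₁, K₃, f, g, h, hT, hK₁, hK₁', hK₃, hK₃'⟩ :=
        exists_stupidTruncation_triangle K (m + 1)
      refine Q.ext_of_isTriangulatedClosed₂ _ hT (hn (m + 1) K₁ fun i hi => ?_)
        (h₂ m K₃ fun i hi => ?_)
      · rcases lt_or_ge i (m + 1) with hi' | hi'
        · exact hK₁ i hi'
        · exact (hK i (by push_cast; lia)).of_iso (hK₁' i hi').some
      · rcases lt_or_ge i (m + 1) with hi' | hi'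
        · exact (hK i (by lia)).of_iso (hK₃' i hi').some
        · exact hK₃ i hi'
  obtain ⟨m, n, hm, hn⟩ := hK
  rw [CochainComplex.isStrictlyGE_iff] at hm
  rw [CochainComplex.isStrictlyLE_iff] at hn
  refine h₃ (n + 1 - m).toNat m K fun i hi => ?_
  rcases hi with hi | hi
  · exact hm i hi
  · exact hn i (by lia)

/-- Axiom `C1` implies that right bounded complexes are resolved by complexes of objects
of `A`. -/
lemma AxiomC1.exists_trW (hE : IsDeflationExact conf) (hC1 : AxiomC1 conf A)
    (X : (minus E).FullSubcategory) :
    ∃ (K : (minus A.FullSubcategory).FullSubcategory) (s : (mapKMinus A.ι).obj K ⟶ X),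
      (thickClosure (acyclicIn (minus E) conf)).trW s := by
  obtain ⟨X, hX⟩ := X
  obtain ⟨X, rfl⟩ := HomotopyCategory.quotient_obj_surjective X
  obtain ⟨n, hn : CochainComplex.IsStrictlyLE X n⟩ := hX
  change CochainComplex E ℤ at X
  obtain ⟨Y : CochainComplex E ℤ, s : Y ⟶ X, hY, hYA, hs, -⟩ :=
    -- With target `0` the lifting condition is empty. The isomorphism closure of `A` is used
    -- because the zero object chosen in `E` need not itself belong to `A`.
    exists_resolution (G := 𝟭 E) (N := 0) (X := X) hE 0 n A.isoClosure
    ⟨0, isZero_zero _, isoClosure_of_isZero (isZero_zero _)⟩ (fun _ => False)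
    (fun j i _ P φ _ => by
      obtain ⟨Y, b, hY, hb⟩ := hC1 P
      exact ⟨Y, b, 0, hb, A.le_isoClosure _ hY,
        ((HomologicalComplex.eval E (.up ℤ) i).map_isZero (isZero_zero _)).eq_of_tgt _ _,
        fun h => h.elim⟩)
  obtain ⟨K, ⟨e⟩⟩ := exists_iso_mapHomologicalComplex Y hYA
  have hK : K.IsStrictlyLE n := (CochainComplex.isStrictlyLE_iff _ _).2 fun i hi =>
    isZero_of_isZero_obj ((CochainComplex.isZero_of_isStrictlyLE Y n i).of_iso
      ((HomologicalComplex.eval _ _ i).mapIso e))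
  let X' : (minus E).FullSubcategory := ⟨(HomotopyCategory.quotient _ _).obj X, n, hn⟩
  let Y' : (minus E).FullSubcategory := ⟨(HomotopyCategory.quotient _ _).obj Y, n, hY⟩
  let s' : Y' ⟶ X' := ObjectProperty.homMk ((HomotopyCategory.quotient _ _).map s)
  have hs' := trW_thickClosure_acyclicIn (minus E) s' s rfl rfl (by simp [s']) hs
    ⟨_, isStrictlyLE_mappingCone s n n⟩
  let K' : (minus A.FullSubcategory).FullSubcategory :=
    ⟨(HomotopyCategory.quotient _ _).obj K, n, hK⟩
  let e' : (mapKMinus A.ι).obj K' ≅ Y' :=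
    (minus E).isoMk ((HomotopyCategory.quotient _ _).mapIso e)
  exact ⟨K', e'.hom ≫ s', MorphismProperty.RespectsIso.precomp _ _ _
    (ObjectProperty.trW_monotone (le_thickClosure _) _ hs')⟩

variable [HasBinaryBiproducts A.FullSubcategory]

lemma factorsThroughThickClosure_mapKMinus (hE : IsDeflationExact conf)
    (hC2' : AxiomC2' conf A) :
    FactorsThroughThickClosure (acyclicIn (minus _) (subConflation conf A))
      (acyclicIn (minus _) conf) (mapKMinus A.ι) := by
  refine factorsThroughThickClosure_mapK hE hC2' _ ?_ ?_
  · rintro X N ⟨n, hn⟩ -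
    exact ⟨n, fun _ => False, hn, fun _ h => h.elim, fun Y hY _ => ⟨n, hY⟩⟩
  · rintro X Y s ⟨n, (_ : X.IsStrictlyLE n)⟩ ⟨m, (_ : Y.IsStrictlyLE m)⟩
    exact ⟨_, isStrictlyLE_mappingCone s m n⟩

lemma factorsThroughThickClosure_mapKBounded (hE : IsDeflationExact conf)
    (hC2' : AxiomC2' conf A) :
    FactorsThroughThickClosure (acyclicIn (bounded _) (subConflation conf A))
      (acyclicIn (bounded _) conf) (mapKBounded A.ι) := by
  refine factorsThroughThickClosure_mapK hE hC2' _ ?_ ?_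
  · rintro X N ⟨m, n, (_ : X.IsStrictlyGE m), hn⟩ ⟨m', -, (_ : N.IsStrictlyGE m'), -⟩
    -- The lower bound for `Y` is one less than `min m m'`, because vanishing in degree `i` needs
    -- the condition in degree `i + 1` too.
    refine ⟨n, fun i => i < min m m', hn, fun i hi => N.isZero_of_isStrictlyGE m' i (by lia),
      fun Y hY hY' => ⟨min m m' - 1, n, ?_, hY⟩⟩
    refine (CochainComplex.isStrictlyGE_iff _ _).2 fun i hi =>
      hY' i (by lia) (by lia) (X.isZero_of_isStrictlyGE m i (by lia))
  · rintro X Y s ⟨m₁, n₁, (_ : X.IsStrictlyGE m₁), (_ : X.IsStrictlyLE n₁)⟩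
      ⟨m₂, n₂, (_ : Y.IsStrictlyGE m₂), (_ : Y.IsStrictlyLE n₂)⟩
    exact ⟨min (m₂ - 1) m₁, _,
      CochainComplex.isStrictlyGE_mappingCone s m₂ m₁ _ (by simp) (by simp),
      isStrictlyLE_mappingCone s n₂ n₁⟩

theorem isEquivalence_mapDMinus (hE : IsDeflationExact conf) (hC1 : AxiomC1 conf A)
    (hC2' : AxiomC2' conf A) : (mapDMinus (isConflationExact_ι conf A)).IsEquivalence := by
  have H := factorsThroughThickClosure_mapKMinus hE hC2'
  have := H.full_verdierFunctor (isConflationExact_ι conf A).acyclicIn_minus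
  have := H.faithful_verdierFunctor (isConflationExact_ι conf A).acyclicIn_minus
  have := essSurj_verdierFunctor _ (isConflationExact_ι conf A).acyclicIn_minus
    (hC1.exists_trW hE)
  exact { }

theorem isEquivalence_mapDBounded (hE : IsDeflationExact conf) (hC2' : AxiomC2' conf A)
    (hres : ∀ X, ∃ n, HasResolutionOfLength conf A X n) :
    (mapDBounded (isConflationExact_ι conf A)).IsEquivalence := by
  have hG := (isConflationExact_ι conf A).acyclicIn_bounded
  have H := factorsThroughThickClosure_mapKBounded hE hC2'
  have := H.full_verdierFunctor hG
  have := H.faithful_verdierFunctor hG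
  have := isTriangulated_verdierFunctor (mapKBounded A.ι) hG
  let L := (thickClosure (acyclicIn (bounded A.FullSubcategory) (subConflation conf A))).trW.Q
  let L' := (thickClosure (acyclicIn (bounded E) conf)).trW.Q
  let F := verdierFunctor (mapKBounded A.ι) hG
  let e : L ⋙ F ≅ mapKBounded A.ι ⋙ L' := Localization.Lifting.iso _
    (thickClosure (acyclicIn (bounded A.FullSubcategory) (subConflation conf A))).trW _ _
  -- Fullness makes the essential image of the triangulated functor `F` a triangulated subcategory;
  -- it is pulled back to bounded complexes and then pushed into the homotopy category, where the
  -- generation argument takes place.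
  let Q : ObjectProperty (bounded E).FullSubcategory := F.essImage.inverseImage L'
  have : F.Full := H.full_verdierFunctor hG
  have : F.IsTriangulated := isTriangulated_verdierFunctor (mapKBounded A.ι) hG
  have : F.essImage.IsTriangulated := inferInstance
  have : Q.IsTriangulated := inferInstance
  have : (Q.map (bounded E).ι).IsTriangulated := inferInstance
  have hQ : ∀ K, Q K := by
    rintro ⟨K, hK⟩
    obtain ⟨K, rfl⟩ := HomotopyCategory.quotient_obj_surjective K
    obtain ⟨K', hK', ⟨e⟩⟩ := prop_of_hasResolutionOfLength (conf := conf) (A := A)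
      (Q.map (bounded E).ι)
      (fun L₀ hL₀ => ⟨(mapKBounded A.ι).obj ⟨_, hL₀⟩, ⟨L.obj _, ⟨e.app _⟩⟩, ⟨Iso.refl _⟩⟩)
      (fun R hR hR' => ⟨⟨_, hR'⟩, by
        let Y : (bounded E).FullSubcategory := ⟨_, hR'⟩
        have hY : thickClosure (acyclicIn (bounded E) conf) Y := le_thickClosure _ _ hR
        -- The cone of `0 ⟶ Y` is the acyclic `Y` itself, so `Y` becomes zero in the quotient.
        have : IsIso (L'.map (0 : 0 ⟶ Y)) :=
          Localization.inverts L' (thickClosure (acyclicIn (bounded E) conf)).trW _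
          (ObjectProperty.trW.mk _ (contractible_distinguished₁ Y) hY)
        have hR₀ : IsZero (L'.obj Y) :=
          (L'.map_isZero (isZero_zero _)).of_iso (asIso (L'.map (0 : 0 ⟶ Y))).symm
        exact F.essImage.prop_of_isZero hR₀, ⟨Iso.refl _⟩⟩)
      hres K hK
    exact Q.prop_of_iso ((bounded E).isoMk e) hK'
  have : F.EssSurj := ⟨fun X => by
    have : L'.EssSurj := Localization.essSurj L' (thickClosure (acyclicIn (bounded E) conf)).trW
    exact F.essImage.prop_of_iso (L'.objObjPreimageIso X) (hQ _)⟩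
  exact { }

end DerivedEquivalences

end OneSidedExact

end

theorem theorem6p11 {E : Type u} [Category.{v} E] [Preadditive E] [HasZeroObject E]
    [HasBinaryBiproducts E] (conf : ObjectProperty (ShortComplex E))
    (hE : OneSidedExact.IsDeflationExact conf)
    (A : ObjectProperty E) [HasZeroObject A.FullSubcategory]
    [HasBinaryBiproducts A.FullSubcategory]
    (hC1 : OneSidedExact.AxiomC1 conf A) (hC2' : OneSidedExact.AxiomC2' conf A) :
    IsGreatest {confA : ObjectProperty (ShortComplex A.FullSubcategory) |
        OneSidedExact.IsDeflationExact confA ∧ OneSidedExact.IsConflationExact A.ι confA conf}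
      (OneSidedExact.subConflation conf A) ∧
    ((OneSidedExact.mapDMinus (OneSidedExact.isConflationExact_ι conf A)).IsTriangulated ∧
      (OneSidedExact.mapDMinus (OneSidedExact.isConflationExact_ι conf A)).IsEquivalence) ∧
    ((∀ X : E, OneSidedExact.resolutionDimension conf A X < ⊤) →
      (OneSidedExact.mapDBounded (OneSidedExact.isConflationExact_ι conf A)).IsTriangulated ∧
      (OneSidedExact.mapDBounded (OneSidedExact.isConflationExact_ι conf A)).IsEquivalence) := by
  refine ⟨OneSidedExact.isGreatest_subConflation A hE,
    ⟨OneSidedExact.isTriangulated_verdierFunctor _ _,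
      OneSidedExact.isEquivalence_mapDMinus hE hC1 hC2'⟩,
    fun hres => ⟨OneSidedExact.isTriangulated_verdierFunctor _ _,
      OneSidedExact.isEquivalence_mapDBounded hE hC2' fun X => ?_⟩⟩
  -- Without any finite resolution the infimum defining the dimension is over an empty family, hence
  -- `⊤`.
  by_contra! h
  have := hres X
  simp [OneSidedExact.resolutionDimension, h] at this
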